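/- Let $d\ge 1$, let $\Omega\subset\mathbb{R}^d$ be a nonempty bounded open set, and let $\lambda_1\le\lambda_2\le\cdots$ be the eigenvalues of the Dirichlet Laplacian $-\Delta$ on $\Omega$, in nondecreasing order and repeated according to multiplicity; that is, the $\lambda_k$ are the real numbers $\mu$ for which there is $0\ne u\in H^1_0(\Omega)$ with $\int_\Omega\nabla u\cdot\nabla v=\mu\int_\Omega uv$ for all $v\in H^1_0(\Omega)$, and such a sequence $(\lambda_k)_{k\ge1}$ exists and satisfies $\lambda_1>0$. For $\sigma>0$ and $z\in\mathbb{R}$ let $$R_\sigma(z):=\sum_{k\ge1}(z-\lambda_k)_+^\sigma,\qquad x_+:=\max(0,x).$$ Then for all real $\sigma\ge 2$ and all $z\ge\left(1+\frac{2\sigma}{d}\right)\lambda_1$ the sum $R_\sigma(z)$ converges and $$\left(\frac{2\sigma}{d}\right)^{\sigma}\lambda_1^{-\frac d2}\left(\frac{z}{1+\frac{2\sigma}{d}}\right)^{\sigma+\frac d2}\;\le\; R_\sigma(z)\;\le\; L^{cl}_{\sigma,d}\,|\Omega|\,z^{\sigma+\frac d2},$$ where $|\Omega|$ is the Lebesgue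 measure of $\Omega$ and $$L^{cl}_{\sigma,d}:=\frac{\Gamma(\sigma+1)}{(4\pi)^{d/2}\,\Gamma\left(\sigma+1+\frac d2\right)}.$$ -/

import Mathlib

open MeasureTheory

noncomputable section

namespace Dirichlet

/-- `C_c^∞(Ω)`: real smooth functions whose support is compact and contained in `Ω`. -/
def IsTestFunction {d : ℕ} (Ω : Set (EuclideanSpace ℝ (Fin d)))
    (φ : EuclideanSpace ℝ (Fin d) → ℝ) : Prop :=
  ContDiff ℝ (⊤ : ℕ∞) φ ∧ HasCompactSupport φ ∧ tsupport φ ⊆ Ω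

/-- Pairs `(φ, ∇φ)` in `L²(Ω) × L²(Ω; ℝ^d)` with `φ ∈ C_c^∞(Ω)`. -/
def testGraph {d : ℕ} (Ω : Set (EuclideanSpace ℝ (Fin d))) :
    Submodule ℝ (Lp ℝ 2 (volume.restrict Ω) ×
      Lp (EuclideanSpace ℝ (Fin d)) 2 (volume.restrict Ω)) where
  carrier := {p | ∃ φ : EuclideanSpace ℝ (Fin d) → ℝ, IsTestFunction Ω φ ∧
    p.1 =ᵐ[volume.restrict Ω] φ ∧ p.2 =ᵐ[volume.restrict Ω] gradient φ}
  zero_mem' := by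
    refine ⟨0, ⟨contDiff_const, HasCompactSupport.zero, by simp [tsupport]⟩,
      Lp.coeFn_zero _ _ _, ?_⟩
    filter_upwards [Lp.coeFn_zero (EuclideanSpace ℝ (Fin d)) 2 (volume.restrict Ω)] with x hx
    simpa [gradient] using hx
  add_mem' := by
    rintro p q ⟨φ, ⟨hφ, hφc, hφs⟩, h1, h2⟩ ⟨ψ, ⟨hψ, hψc, hψs⟩, h3, h4⟩
    refine ⟨φ + ψ, ⟨hφ.add hψ, hφc.add hψc,
      (tsupport_add φ ψ).trans (Set.union_subset hφs hψs)⟩, ?_, ?_⟩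
    · filter_upwards [Lp.coeFn_add p.1 q.1, h1, h3] with x hx h1 h3
      rw [Prod.fst_add, hx, Pi.add_apply, Pi.add_apply, h1, h3]
    · filter_upwards [Lp.coeFn_add p.2 q.2, h2, h4] with x hx h2 h4
      have e := fderiv_add ((hφ.differentiable (by simp)) x) ((hψ.differentiable (by simp)) x)
      rw [Prod.snd_add, hx, Pi.add_apply, h2, h4, gradient, gradient, gradient, e, map_add]
  smul_mem' := by
    rintro c p ⟨φ, ⟨hφ, hφc, hφs⟩, h1, h2⟩
    refine ⟨c • φ, ⟨hφ.const_smul c, hφc.smul_left (f := fun _ => c),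
      (tsupport_smul_subset_right (fun _ => c) φ).trans hφs⟩, ?_, ?_⟩
    · filter_upwards [Lp.coeFn_smul c p.1, h1] with x hx h1
      simp [hx, h1]
    · filter_upwards [Lp.coeFn_smul c p.2, h2] with x hx h2
      have e := fderiv_const_smul ((hφ.differentiable (by simp)) x) c
      simp [hx, h2, gradient, e]

/-- The Sobolev space `H¹₀(Ω)`, as the set of pairs `(u, ∇u)`: the closure of
`C_c^∞(Ω)` in the `H¹` norm. -/
def sobolevH10 {d : ℕ} (Ω : Set (EuclideanSpace ℝ (Fin d))) :
    Submodule ℝ (Lp ℝ 2 (volume.restrict Ω) ×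
      Lp (EuclideanSpace ℝ (Fin d)) 2 (volume.restrict Ω)) :=
  (testGraph Ω).topologicalClosure

/-- The eigenspace of the Dirichlet Laplacian `-Δ` on `Ω` at `μ`: all `u ∈ H¹₀(Ω)` with
`∫_Ω ∇u · ∇v = μ ∫_Ω u v` for every `v ∈ H¹₀(Ω)`. -/
def eigenspace {d : ℕ} (Ω : Set (EuclideanSpace ℝ (Fin d))) (μ : ℝ) :
    Submodule ℝ (Lp ℝ 2 (volume.restrict Ω)) where
  carrier := {u | ∃ g, (u, g) ∈ sobolevH10 Ω ∧
    ∀ q ∈ sobolevH10 Ω, inner ℝ g q.2 = μ * inner ℝ u q.1}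
  zero_mem' := ⟨0, (sobolevH10 Ω).zero_mem, fun q _ => by simp⟩
  add_mem' := by
    rintro u v ⟨g, hg, hu⟩ ⟨h, hh, hv⟩
    refine ⟨g + h, (sobolevH10 Ω).add_mem hg hh, fun q hq => ?_⟩
    rw [inner_add_left, inner_add_left, hu q hq, hv q hq]
    ring
  smul_mem' := by
    rintro c u ⟨g, hg, hu⟩
    refine ⟨c • g, (sobolevH10 Ω).smul_mem c hg, fun q hq => ?_⟩
    rw [real_inner_smul_left, real_inner_smul_left, hu q hq]
    ring

/-- `lam 0 ≤ lam 1 ≤ …` lists the eigenvalues of the Dirichlet Laplacian on `Ω`, each one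
as often as its multiplicity; in the usual numbering from one, `λ_k = lam (k - 1)`. -/
structure IsSpectrum {d : ℕ} (Ω : Set (EuclideanSpace ℝ (Fin d))) (lam : ℕ → ℝ) : Prop where
  monotone : Monotone lam
  multiplicity : ∀ μ : ℝ,
    {k : ℕ | lam k = μ}.encard = Cardinal.toENat (Module.rank ℝ (eigenspace Ω μ))

/-- The terms `(z - λ_k)_+^σ` of the Riesz mean. -/
def rieszTerm (lam : ℕ → ℝ) (σ z : ℝ) (k : ℕ) : ℝ := (max 0 (z - lam k)) ^ σ

/-- The Riesz mean `R_σ(z) = ∑_k (z - λ_k)_+^σ` of order `σ > 0`. -/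
def rieszMean (lam : ℕ → ℝ) (σ z : ℝ) : ℝ := ∑' k, rieszTerm lam σ z k

/-- The classical constant `L^cl_{σ,d}`. -/
def classicalConst (σ : ℝ) (d : ℕ) : ℝ :=
  Real.Gamma (σ + 1) /
    ((4 * Real.pi) ^ ((d : ℝ) / 2) * Real.Gamma (σ + 1 + (d : ℝ) / 2))

end Dirichlet

end

open MeasureTheory

noncomputable section

namespace Dirichlet

/-! Upper bound (Berezin–Li–Yau). Let `h(t) = (z - t)_+^σ`, which is convex. A normalised
eigenfunction `u` with eigenvalue `μ`, extended by zero, makes `|û|²` a probability density in which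
`4π²|ξ|²` has mean `μ`. Jensen's inequality gives `h(μ) ≤ ∫ h(4π²|ξ|²) |û(ξ)|² dξ`
(`rieszFun_le_integral`). Summing over orthonormal eigenfunctions, Bessel's inequality for plane
waves bounds `∑ |û_k(ξ)|²` by `|Ω|`, and the remaining integral is a Beta integral equal to the
classical constant.

Lower bound (Harrell–Stubbe). The commutator of `-Δ` with `x_a` is `-2∂_a`. Parseval's identity then
gives two sum rules for the weights `W_kj = ∑_a ⟨u_k, x_a u_j⟩²`: `∑_k (λ_k - λ_j) W_kj = d` and
`∑_k (λ_k - λ_j)² W_kj = 4λ_j`. Combined with convexity of `t^(σ-1)`, which is where `σ ≥ 2` enters,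
they yield `(d + 2σ) R_σ(z) ≤ 2σ z R_{σ-1}(z)`. Since `R_σ' = σ R_{σ-1}`, the quotient `R_σ(z) /
z^(σ+d/2)` is nondecreasing. Comparing `z` with `y = (1 + 2σ/d) λ_1` and keeping only the first
eigenvalue in `R_σ(y)` gives the bound.

Spectrum. The Fourier form inequality behind the upper bound also shows that `H¹₀(Ω) → L²(Ω)` is
compact, so the spectral theorem yields completeness of the eigenfunctions. Berezin–Li–Yau with `σ =
1` makes the eigenvalues locally finite, and the first sum rule shows that there are infinitely
many. -/

variable {d : ℕ} {Ω : Set (EuclideanSpace ℝ (Fin d))}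

/-! ### Vector fields in `L²` and their components -/

/-- The space `L²(Ω)`. -/
abbrev L2 (Ω : Set (EuclideanSpace ℝ (Fin d))) := Lp ℝ 2 (volume.restrict Ω)

/-- The space `L²(Ω; ℝ^d)`. -/
abbrev L2Vec (Ω : Set (EuclideanSpace ℝ (Fin d))) :=
  Lp (EuclideanSpace ℝ (Fin d)) 2 (volume.restrict Ω)

theorem isFiniteMeasure_restrict (hb : Bornology.IsBounded Ω) :
    IsFiniteMeasure (volume.restrict Ω) :=
  ⟨by simpa using hb.measure_lt_top⟩

/-- The `a`-th component of a vector field. -/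
def component (Ω : Set (EuclideanSpace ℝ (Fin d))) (a : Fin d) : L2Vec Ω →L[ℝ] L2 Ω :=
  (EuclideanSpace.proj a : EuclideanSpace ℝ (Fin d) →L[ℝ] ℝ).compLpL 2 _

/-- The vector field `u e_a`. -/
def axisField (Ω : Set (EuclideanSpace ℝ (Fin d))) (a : Fin d) : L2 Ω →L[ℝ] L2Vec Ω :=
  ((ContinuousLinearMap.id ℝ ℝ).smulRight (EuclideanSpace.single a (1 : ℝ))).compLpL 2 _

theorem component_coe (a : Fin d) (g : L2Vec Ω) :
    component Ω a g =ᵐ[volume.restrict Ω] fun x => g x a :=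
  ContinuousLinearMap.coeFn_compLpL _ _

theorem axisField_coe (a : Fin d) (u : L2 Ω) :
    axisField Ω a u =ᵐ[volume.restrict Ω] fun x => u x • EuclideanSpace.single a (1 : ℝ) :=
  ContinuousLinearMap.coeFn_compLpL _ _

theorem inner_axisField (a : Fin d) (g : L2Vec Ω) (u : L2 Ω) :
    inner ℝ g (axisField Ω a u) = inner ℝ (component Ω a g) u := by
  rw [L2.inner_def, L2.inner_def]
  refine integral_congr_ae ?_
  filter_upwards [component_coe a g, axisField_coe a u] with x h1 h2
  rw [h1, h2, real_inner_smul_right, EuclideanSpace.inner_single_right]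
  simp

theorem inner_eq_sum_component (g h : L2Vec Ω) :
    inner ℝ g h = ∑ a, inner ℝ (component Ω a g) (component Ω a h) := by
  simp_rw [L2.inner_def]
  rw [← integral_finsetSum _ fun a _ => L2.integrable_inner _ _]
  refine integral_congr_ae ?_
  filter_upwards [Filter.eventually_all.2 fun a => component_coe a g,
    Filter.eventually_all.2 fun a => component_coe a h] with x h1 h2
  rw [PiLp.inner_apply]
  exact Finset.sum_congr rfl fun a _ => by rw [h1 a, h2 a]

theorem norm_sq_eq_sum_component (g : L2Vec Ω) :
    ‖g‖ ^ 2 = ∑ a, ‖component Ω a g‖ ^ 2 := by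
  simp_rw [← real_inner_self_eq_norm_sq]
  exact inner_eq_sum_component g g

/-! ### Multiplication by coordinates, bounded because `Ω` is -/

section Coordinate

theorem memLp_top_coord (ho : IsOpen Ω) (hb : Bornology.IsBounded Ω) (a : Fin d) :
    MemLp (fun x : EuclideanSpace ℝ (Fin d) => x a) ⊤ (volume.restrict Ω) := by
  obtain ⟨R, hR⟩ := hb.exists_norm_le
  refine memLp_top_of_bound (by fun_prop) R ?_
  filter_upwards [ae_restrict_mem ho.measurableSet] with x hx
  exact (PiLp.norm_apply_le x a).trans (hR x hx)

/-- Multiplication by the coordinate `x_a` on `L²(Ω; F)`. -/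
def coordMul (ho : IsOpen Ω) (hb : Bornology.IsBounded Ω) (a : Fin d)
    (F : Type*) [NormedAddCommGroup F] [NormedSpace ℝ F] :
    Lp F 2 (volume.restrict Ω) →L[ℝ] Lp F 2 (volume.restrict Ω) :=
  (ContinuousLinearMap.lsmul ℝ ℝ : ℝ →L[ℝ] F →L[ℝ] F).holderL (volume.restrict Ω) ⊤ 2 2
    (memLp_top_coord ho hb a).toLp

variable (ho : IsOpen Ω) (hb : Bornology.IsBounded Ω) (a : Fin d)
  {F : Type*} [NormedAddCommGroup F]

theorem coordMul_coe [NormedSpace ℝ F] (u : Lp F 2 (volume.restrict Ω)) :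
    coordMul ho hb a F u =ᵐ[volume.restrict Ω] fun x => x a • u x := by
  rw [coordMul, ContinuousLinearMap.holderL_apply_apply]
  filter_upwards [ContinuousLinearMap.coeFn_holder (r := 2)
    (ContinuousLinearMap.lsmul ℝ ℝ : ℝ →L[ℝ] F →L[ℝ] F) (memLp_top_coord ho hb a).toLp u,
    (memLp_top_coord ho hb a).coeFn_toLp] with x h1 h2
  rw [h1, h2]
  rfl

theorem inner_coordMul_left [InnerProductSpace ℝ F] (u v : Lp F 2 (volume.restrict Ω)) :
    inner ℝ (coordMul ho hb a F u) v = inner ℝ u (coordMul ho hb a F v) := by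
  rw [L2.inner_def, L2.inner_def]
  refine integral_congr_ae ?_
  filter_upwards [coordMul_coe ho hb a u, coordMul_coe ho hb a v] with x h1 h2
  rw [h1, h2, real_inner_smul_left, real_inner_smul_right]

theorem component_coordMul (b : Fin d) (g : L2Vec Ω) :
    component Ω b (coordMul ho hb a _ g) = coordMul ho hb a _ (component Ω b g) := by
  refine Lp.ext ?_
  filter_upwards [coordMul_coe ho hb a g, coordMul_coe ho hb a (component Ω b g),
    component_coe b g, component_coe b (coordMul ho hb a _ g)] with x h1 h2 h3 h4
  rw [h4, h1, h2, h3]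
  rfl

end Coordinate

theorem component_axisField (a : Fin d) (u : L2 Ω) : component Ω a (axisField Ω a u) = u := by
  refine Lp.ext ?_
  filter_upwards [axisField_coe a u, component_coe a (axisField Ω a u)] with x h1 h2
  rw [h2, h1]
  simp

/-! ### Calculus of test functions -/

section TestFunction

variable {φ ψ : EuclideanSpace ℝ (Fin d) → ℝ}

theorem gradient_apply (x : EuclideanSpace ℝ (Fin d)) (a : Fin d) :
    gradient φ x a = fderiv ℝ φ x (EuclideanSpace.single a 1) := by
  have h : inner ℝ (gradient φ x) (EuclideanSpace.single a (1 : ℝ)) =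
      fderiv ℝ φ x (EuclideanSpace.single a 1) := by
    rw [gradient, InnerProductSpace.toDual_symm_apply]
  rw [← h, EuclideanSpace.inner_single_right]
  simp

namespace IsTestFunction

theorem continuous (hφ : IsTestFunction Ω φ) : Continuous φ := hφ.1.continuous

theorem differentiable (hφ : IsTestFunction Ω φ) : Differentiable ℝ φ :=
  hφ.1.differentiable (by simp)

theorem continuous_gradient (hφ : IsTestFunction Ω φ) : Continuous (gradient φ) :=
  (InnerProductSpace.toDual ℝ _).symm.continuous.comp (hφ.1.continuous_fderiv (by simp))

theorem hasCompactSupport_gradient (hφ : IsTestFunction Ω φ) : HasCompactSupport (gradient φ) :=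
  (hφ.2.1.fderiv ℝ).comp_left (g := (InnerProductSpace.toDual ℝ _).symm) (map_zero _)

theorem memLp (hφ : IsTestFunction Ω φ) (μ : Measure (EuclideanSpace ℝ (Fin d)))
    [IsFiniteMeasureOnCompacts μ] : MemLp φ 2 μ :=
  hφ.continuous.memLp_of_hasCompactSupport hφ.2.1

theorem memLp_gradient (hφ : IsTestFunction Ω φ) (μ : Measure (EuclideanSpace ℝ (Fin d)))
    [IsFiniteMeasureOnCompacts μ] : MemLp (gradient φ) 2 μ :=
  hφ.continuous_gradient.memLp_of_hasCompactSupport hφ.hasCompactSupport_gradient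

/-- The pair `(φ, ∇φ)` as an element of `L²(Ω) × L²(Ω; ℝ^d)`. -/
def toPair (hφ : IsTestFunction Ω φ) : L2 Ω × L2Vec Ω :=
  ((hφ.memLp _).toLp, (hφ.memLp_gradient _).toLp)

theorem toPair_mem (hφ : IsTestFunction Ω φ) : hφ.toPair ∈ testGraph Ω :=
  ⟨φ, hφ, (hφ.memLp _).coeFn_toLp, (hφ.memLp_gradient _).coeFn_toLp⟩

theorem toPair_mem_sobolevH10 (hφ : IsTestFunction Ω φ) : hφ.toPair ∈ sobolevH10 Ω :=
  Submodule.le_topologicalClosure _ hφ.toPair_mem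

theorem eq_zero_of_notMem (hφ : IsTestFunction Ω φ) {x : EuclideanSpace ℝ (Fin d)} (hx : x ∉ Ω) :
    φ x = 0 :=
  image_eq_zero_of_notMem_tsupport fun h => hx (hφ.2.2 h)

theorem gradient_eq_zero_of_notMem (hφ : IsTestFunction Ω φ) {x : EuclideanSpace ℝ (Fin d)}
    (hx : x ∉ Ω) : gradient φ x = 0 := by
  have : fderiv ℝ φ x = 0 :=
    image_eq_zero_of_notMem_tsupport fun h => hx (hφ.2.2 (tsupport_fderiv_subset ℝ h))
  rw [gradient, this, map_zero]

theorem coord_mul (hφ : IsTestFunction Ω φ) (a : Fin d) :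
    IsTestFunction Ω (fun x => x a * φ x) := by
  refine ⟨ContDiff.mul (by fun_prop) hφ.1, hφ.2.1.mul_left,
    (tsupport_mul_subset_right (f := fun x : EuclideanSpace ℝ (Fin d) => x a)).trans hφ.2.2⟩

theorem gradient_coord_mul (hφ : IsTestFunction Ω φ) (a : Fin d) (x : EuclideanSpace ℝ (Fin d)) :
    gradient (fun x => x a * φ x) x =
      x a • gradient φ x + φ x • EuclideanSpace.single a (1 : ℝ) := by
  ext b
  rw [gradient_apply]
  have h1 : HasFDerivAt (fun x : EuclideanSpace ℝ (Fin d) => x a)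
      (EuclideanSpace.proj a : EuclideanSpace ℝ (Fin d) →L[ℝ] ℝ) x :=
    (EuclideanSpace.proj a : EuclideanSpace ℝ (Fin d) →L[ℝ] ℝ).hasFDerivAt
  have h2 : fderiv ℝ (fun x => x a * φ x) x = _ :=
    (h1.mul (hφ.differentiable x).hasFDerivAt).fderiv
  rw [h2]
  simp [gradient_apply, eq_comm]

theorem integral_partial_mul (hφ : IsTestFunction Ω φ) (hψ : IsTestFunction Ω ψ) (a : Fin d) :
    ∫ x, gradient φ x a * ψ x = -∫ x, φ x * gradient ψ x a := by
  have hc : ∀ {χ : EuclideanSpace ℝ (Fin d) → ℝ}, IsTestFunction Ω χ →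
      Continuous fun x => gradient χ x a := fun h =>
    (EuclideanSpace.proj a : EuclideanSpace ℝ (Fin d) →L[ℝ] ℝ).continuous.comp
      h.continuous_gradient
  have h1 : Integrable fun x => gradient φ x a * ψ x :=
    ((hc hφ).mul hψ.continuous).integrable_of_hasCompactSupport hψ.2.1.mul_left
  have h2 : Integrable fun x => φ x * gradient ψ x a :=
    (hφ.continuous.mul (hc hψ)).integrable_of_hasCompactSupport hφ.2.1.mul_right
  have h3 : Integrable fun x => φ x * ψ x :=
    (hφ.continuous.mul hψ.continuous).integrable_of_hasCompactSupport hφ.2.1.mul_right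
  simp only [gradient_apply] at h1 h2 ⊢
  rw [integral_mul_fderiv_eq_neg_fderiv_mul_of_integrable h1 h2 h3
    (fun x _ => hφ.differentiable x) (fun x _ => hψ.differentiable x), neg_neg]

end IsTestFunction

end TestFunction

/-! ### Identities on `H¹₀(Ω)` -/

/-- Density argument: a relation continuous in `(u, ∇u)` need only be checked on test functions. -/
theorem sobolevH10_induction {P : L2 Ω × L2Vec Ω → Prop} (hc : IsClosed {p | P p})
    (h : ∀ φ (hφ : IsTestFunction Ω φ), P hφ.toPair) {p : L2 Ω × L2Vec Ω}
    (hp : p ∈ sobolevH10 Ω) : P p := by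
  refine closure_minimal (t := {p | P p}) ?_ hc hp
  rintro q ⟨φ, hφ, h1, h2⟩
  have : q = hφ.toPair := Prod.ext (Lp.ext (h1.trans (hφ.memLp _).coeFn_toLp.symm))
    (Lp.ext (h2.trans (hφ.memLp_gradient _).coeFn_toLp.symm))
  exact this ▸ h φ hφ

/-- Product rule `∇(x_a u) = x_a ∇u + u e_a`, passed to the closure. It makes `x_a u` an admissible
function in the weak eigenvalue equation. -/
theorem coordMul_mem (ho : IsOpen Ω) (hb : Bornology.IsBounded Ω) (a : Fin d)
    {p : L2 Ω × L2Vec Ω} (hp : p ∈ sobolevH10 Ω) :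
    (coordMul ho hb a ℝ p.1, coordMul ho hb a _ p.2 + axisField Ω a p.1) ∈ sobolevH10 Ω := by
  refine sobolevH10_induction (P := fun p => (coordMul ho hb a ℝ p.1,
    coordMul ho hb a _ p.2 + axisField Ω a p.1) ∈ sobolevH10 Ω) ?_ (fun φ hφ => ?_) hp
  · refine (Submodule.isClosed_topologicalClosure (testGraph Ω)).preimage
      (f := fun p : L2 Ω × L2Vec Ω =>
        (coordMul ho hb a ℝ p.1, coordMul ho hb a _ p.2 + axisField Ω a p.1)) ?_
    fun_prop
  · refine Submodule.le_topologicalClosure _ ⟨_, hφ.coord_mul a, ?_, ?_⟩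
    · filter_upwards [coordMul_coe ho hb a hφ.toPair.1, (hφ.memLp _).coeFn_toLp] with x h1 h2
      rw [h1]
      simp only [IsTestFunction.toPair, smul_eq_mul]
      rw [h2]
    · filter_upwards [coordMul_coe ho hb a hφ.toPair.2, (hφ.memLp _).coeFn_toLp,
        (hφ.memLp_gradient _).coeFn_toLp, axisField_coe a hφ.toPair.1,
        Lp.coeFn_add (coordMul ho hb a _ hφ.toPair.2) (axisField Ω a hφ.toPair.1)]
        with x h1 h2 h3 h4 h5
      rw [h5, Pi.add_apply, h1, h4, hφ.gradient_coord_mul a x]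
      simp only [IsTestFunction.toPair]
      rw [h2, h3]

/-- Integration by parts without boundary term, by density in each argument separately. -/
theorem inner_component_eq_neg (a : Fin d)
    {p q : L2 Ω × L2Vec Ω} (hp : p ∈ sobolevH10 Ω) (hq : q ∈ sobolevH10 Ω) :
    inner ℝ (component Ω a p.2) q.1 = -inner ℝ p.1 (component Ω a q.2) := by
  refine sobolevH10_induction (P := fun p => inner ℝ (component Ω a p.2) q.1 =
    -inner ℝ p.1 (component Ω a q.2)) (isClosed_eq (by fun_prop) (by fun_prop))
    (fun φ hφ => ?_) hp
  refine sobolevH10_induction (P := fun q => inner ℝ (component Ω a hφ.toPair.2) q.1 =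
    -inner ℝ hφ.toPair.1 (component Ω a q.2)) (isClosed_eq (by fun_prop) (by fun_prop))
    (fun ψ hψ => ?_) hq
  rw [L2.inner_def, L2.inner_def]
  have h1 : ∫ x in Ω, gradient φ x a * ψ x = ∫ x, gradient φ x a * ψ x :=
    setIntegral_eq_integral_of_forall_compl_eq_zero fun x hx => by
      rw [hψ.eq_zero_of_notMem hx, mul_zero]
  have h2 : ∫ x in Ω, φ x * gradient ψ x a = ∫ x, φ x * gradient ψ x a :=
    setIntegral_eq_integral_of_forall_compl_eq_zero fun x hx => by
      rw [hφ.eq_zero_of_notMem hx, zero_mul]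
  have h := hφ.integral_partial_mul hψ a
  rw [← h1, ← h2] at h
  refine Eq.trans ?_ (h.trans (congrArg Neg.neg ?_))
  · refine integral_congr_ae ?_
    filter_upwards [component_coe a hφ.toPair.2, (hφ.memLp_gradient _).coeFn_toLp,
      (hψ.memLp _).coeFn_toLp] with x h1 h2 h3
    rw [h1]
    simp only [IsTestFunction.toPair]
    rw [h2, h3]
    simp [mul_comm]
  · refine (integral_congr_ae ?_).symm
    filter_upwards [component_coe a hψ.toPair.2, (hψ.memLp_gradient _).coeFn_toLp,
      (hφ.memLp _).coeFn_toLp] with x h1 h2 h3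
    rw [h1]
    simp only [IsTestFunction.toPair]
    rw [h2, h3]
    simp [mul_comm]

/-- Integration by parts of `u` against `x_a u`. This is the canonical commutation relation of `∂_a`
and `x_a`; it serves both as a substitute for Poincaré's inequality and as the value of the first
sum rule. -/
theorem norm_sq_eq_neg_two_mul_inner (ho : IsOpen Ω) (hb : Bornology.IsBounded Ω) (a : Fin d)
    {p : L2 Ω × L2Vec Ω} (hp : p ∈ sobolevH10 Ω) :
    ‖p.1‖ ^ 2 = -2 * inner ℝ (component Ω a p.2) (coordMul ho hb a ℝ p.1) := by
  have h := inner_component_eq_neg a hp (coordMul_mem ho hb a hp)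
  simp only [map_add, component_coordMul, component_axisField, inner_add_right,
    real_inner_self_eq_norm_sq] at h
  rw [real_inner_comm _ p.1, inner_coordMul_left] at h
  linarith

theorem eq_zero_of_forall_inner_eq_zero (ho : IsOpen Ω) {f : L2 Ω}
    (h : ∀ p ∈ sobolevH10 Ω, inner ℝ f p.1 = 0) : f = 0 := by
  have hf : LocallyIntegrableOn f Ω :=
    locallyIntegrableOn_of_locallyIntegrable_restrict ((Lp.memLp f).locallyIntegrable (by norm_num))
  have := ho.ae_eq_zero_of_integral_contDiff_smul_eq_zero hf ?_
  · refine Lp.ext ?_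
    filter_upwards [(ae_restrict_iff' ho.measurableSet).2 this,
      Lp.coeFn_zero ℝ 2 (volume.restrict Ω)] with x h1 h2
    rw [h1, h2]; rfl
  · intro φ h1 h2 h3
    have hφ : IsTestFunction Ω φ := ⟨h1, h2, h3⟩
    rw [← setIntegral_eq_integral_of_forall_compl_eq_zero (s := Ω) fun x hx => by
      rw [hφ.eq_zero_of_notMem hx, zero_smul]]
    rw [← h _ hφ.toPair_mem_sobolevH10, L2.inner_def]
    refine integral_congr_ae ?_
    filter_upwards [(hφ.memLp _).coeFn_toLp] with x h3
    simp only [IsTestFunction.toPair]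
    rw [h3]
    simp

/-! ### Plane waves and the Fourier transform on `L²(Ω)` -/

theorem memLp_wave (hb : Bornology.IsBounded Ω) (θ : ℝ) (ξ : EuclideanSpace ℝ (Fin d)) :
    MemLp (fun x => Real.cos (2 * Real.pi * inner ℝ x ξ - θ)) 2 (volume.restrict Ω) := by
  have := isFiniteMeasure_restrict hb
  refine MemLp.of_bound (by fun_prop) 1 (ae_of_all _ fun x => ?_)
  exact Real.abs_cos_le_one _

/-- The plane wave `cos (2π x·ξ - θ)` as an element of `L²(Ω)`. -/
def wave (hb : Bornology.IsBounded Ω) (θ : ℝ) (ξ : EuclideanSpace ℝ (Fin d)) : L2 Ω :=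
  (memLp_wave hb θ ξ).toLp

theorem wave_coe (hb : Bornology.IsBounded Ω) (θ : ℝ) (ξ : EuclideanSpace ℝ (Fin d)) :
    wave hb θ ξ =ᵐ[volume.restrict Ω] fun x => Real.cos (2 * Real.pi * inner ℝ x ξ - θ) :=
  (memLp_wave hb θ ξ).coeFn_toLp

/-- The cosine is 1-Lipschitz and `‖x‖` is bounded on `Ω`. Uniformity in the phase and frequency is
what the covering argument for compactness needs. -/
theorem exists_norm_wave_sub_le (ho : IsOpen Ω) (hb : Bornology.IsBounded Ω) :
    ∃ C : ℝ, 0 ≤ C ∧ ∀ θ ξ η, ‖wave hb θ ξ - wave hb θ η‖ ≤ C * ‖ξ - η‖ := by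
  have := isFiniteMeasure_restrict hb
  obtain ⟨R, hR0, hR⟩ := hb.exists_pos_norm_le
  refine ⟨(measureUnivNNReal (volume.restrict Ω) : ℝ) ^ (2 : ENNReal).toReal⁻¹ *
    (2 * Real.pi * R), by positivity, fun θ ξ η => ?_⟩
  rw [mul_assoc]
  refine Lp.norm_le_of_ae_bound (by positivity) ?_
  filter_upwards [ae_restrict_mem ho.measurableSet, wave_coe hb θ ξ, wave_coe hb θ η,
    Lp.coeFn_sub (wave hb θ ξ) (wave hb θ η)] with x hx h1 h2 h3
  rw [h3, Pi.sub_apply, h1, h2, Real.norm_eq_abs]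
  refine (Real.abs_cos_sub_cos_le _ _).trans ?_
  have e : 2 * Real.pi * inner ℝ x ξ - θ - (2 * Real.pi * inner ℝ x η - θ) =
      2 * Real.pi * inner ℝ x (ξ - η) := by rw [inner_sub_right]; ring
  rw [e, abs_mul, abs_of_pos Real.two_pi_pos, mul_assoc (2 * Real.pi)]
  refine mul_le_mul_of_nonneg_left ?_ Real.two_pi_pos.le
  exact (abs_real_inner_le_norm _ _).trans
    (mul_le_mul_of_nonneg_right (hR x hx) (norm_nonneg _))

theorem continuous_wave (ho : IsOpen Ω) (hb : Bornology.IsBounded Ω) (θ : ℝ) :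
    Continuous (wave hb θ) := by
  obtain ⟨C, hC, h⟩ := exists_norm_wave_sub_le ho hb
  refine (LipschitzWith.of_dist_le_mul (K := ⟨C, hC⟩) fun ξ η => ?_).continuous
  rw [dist_eq_norm, dist_eq_norm]
  exact h θ ξ η

/-- The phases `0` and `π/2` give cosine and sine, the real and imaginary parts of a wave of modulus
one. -/
theorem norm_sq_wave_add (hb : Bornology.IsBounded Ω) (ξ : EuclideanSpace ℝ (Fin d)) :
    ‖wave hb 0 ξ‖ ^ 2 + ‖wave hb (Real.pi / 2) ξ‖ ^ 2 = volume.real Ω := by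
  have := isFiniteMeasure_restrict hb
  rw [← real_inner_self_eq_norm_sq, ← real_inner_self_eq_norm_sq, L2.inner_def, L2.inner_def,
    ← integral_add (L2.integrable_inner _ _) (L2.integrable_inner _ _)]
  trans ∫ _ in Ω, (1 : ℝ)
  · refine integral_congr_ae ?_
    filter_upwards [wave_coe hb 0 ξ, wave_coe hb (Real.pi / 2) ξ] with x h1 h2
    rw [h1, h2, Real.cos_sub_pi_div_two]
    simp
  · simp

/-- The squared modulus of the Fourier transform of `u ∈ L²(Ω)`, extended by zero. -/
def fourierPower (hb : Bornology.IsBounded Ω) (u : L2 Ω) (ξ : EuclideanSpace ℝ (Fin d)) : ℝ :=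
  inner ℝ u (wave hb 0 ξ) ^ 2 + inner ℝ u (wave hb (Real.pi / 2) ξ) ^ 2

theorem fourierPower_nonneg (hb : Bornology.IsBounded Ω) (u : L2 Ω)
    (ξ : EuclideanSpace ℝ (Fin d)) : 0 ≤ fourierPower hb u ξ := by
  unfold fourierPower; positivity

theorem fourierPower_le (hb : Bornology.IsBounded Ω) (u : L2 Ω)
    (ξ : EuclideanSpace ℝ (Fin d)) : fourierPower hb u ξ ≤ ‖u‖ ^ 2 * volume.real Ω := by
  have h : ∀ v : L2 Ω, inner ℝ u v ^ 2 ≤ ‖u‖ ^ 2 * ‖v‖ ^ 2 := fun v => by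
    rw [← mul_pow, ← sq_abs (inner ℝ u v)]
    gcongr
    exact abs_real_inner_le_norm u v
  rw [← norm_sq_wave_add hb ξ, mul_add]
  exact add_le_add (h _) (h _)

theorem continuous_fourierPower (ho : IsOpen Ω) (hb : Bornology.IsBounded Ω) (u : L2 Ω) :
    Continuous (fourierPower hb u) := by
  have := continuous_wave ho hb
  unfold fourierPower
  fun_prop

/-- Bessel's inequality for plane waves. -/
theorem sum_fourierPower_le (hb : Bornology.IsBounded Ω) {ι : Type*} {u : ι → L2 Ω}
    (hu : Orthonormal ℝ u) (s : Finset ι) (ξ : EuclideanSpace ℝ (Fin d)) :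
    ∑ i ∈ s, fourierPower hb (u i) ξ ≤ volume.real Ω := by
  unfold fourierPower
  rw [Finset.sum_add_distrib, ← norm_sq_wave_add hb ξ]
  have h : ∀ v : L2 Ω, ∑ i ∈ s, inner ℝ (u i) v ^ 2 ≤ ‖v‖ ^ 2 := fun v => by
    simpa [sq_abs] using hu.sum_inner_products_le v (s := s)
  exact add_le_add (h _) (h _)

/-! ### Fourier multipliers with compactly supported symbol -/

section Symbol

variable {h : ℝ → ℝ} {z : ℝ}

theorem continuous_symbol (hc : Continuous h) :
    Continuous fun ξ : EuclideanSpace ℝ (Fin d) => h (4 * Real.pi ^ 2 * ‖ξ‖ ^ 2) := by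
  fun_prop

theorem le_four_pi_sq_mul_norm_sq {ξ : EuclideanSpace ℝ (Fin d)} (hξ : √z ≤ ‖ξ‖) :
    z ≤ 4 * Real.pi ^ 2 * ‖ξ‖ ^ 2 := by
  -- The ball of radius `√z` is larger than needed; only `4π² ≥ 1` is used.
  have h1 : z ≤ ‖ξ‖ ^ 2 := (Real.sqrt_le_left (norm_nonneg ξ)).1 hξ
  have h2 : 1 ≤ 4 * Real.pi ^ 2 := by nlinarith [Real.pi_gt_three]
  nlinarith [sq_nonneg ‖ξ‖]

theorem hasCompactSupport_symbol (hz : ∀ t, z ≤ t → h t = 0) :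
    HasCompactSupport fun ξ : EuclideanSpace ℝ (Fin d) => h (4 * Real.pi ^ 2 * ‖ξ‖ ^ 2) := by
  refine HasCompactSupport.intro (isCompact_closedBall 0 (√z)) fun ξ hξ => hz _ ?_
  exact le_four_pi_sq_mul_norm_sq (by simpa using hξ : √z < ‖ξ‖).le

theorem integrable_symbol (hc : Continuous h) (hz : ∀ t, z ≤ t → h t = 0) :
    Integrable fun ξ : EuclideanSpace ℝ (Fin d) => h (4 * Real.pi ^ 2 * ‖ξ‖ ^ 2) :=
  (continuous_symbol hc).integrable_of_hasCompactSupport (hasCompactSupport_symbol hz)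

theorem integrable_symbol_mul_fourierPower (ho : IsOpen Ω) (hb : Bornology.IsBounded Ω)
    (hc : Continuous h) (hz : ∀ t, z ≤ t → h t = 0) (u : L2 Ω) :
    Integrable fun ξ => h (4 * Real.pi ^ 2 * ‖ξ‖ ^ 2) * fourierPower hb u ξ :=
  ((continuous_symbol hc).mul (continuous_fourierPower ho hb u)).integrable_of_hasCompactSupport
    (hasCompactSupport_symbol hz).mul_right

/-- Dominated convergence: the symbol has compact support and the Fourier power is bounded uniformly
near `u₀`. This lets inequalities for test functions pass to `H¹₀(Ω)`. -/
theorem continuous_integral_symbol (ho : IsOpen Ω) (hb : Bornology.IsBounded Ω)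
    (hc : Continuous h) (hz : ∀ t, z ≤ t → h t = 0) :
    Continuous fun u : L2 Ω =>
      ∫ ξ, h (4 * Real.pi ^ 2 * ‖ξ‖ ^ 2) * fourierPower hb u ξ := by
  refine continuous_iff_continuousAt.2 fun u₀ => ?_
  refine continuousAt_of_dominated
    (bound := fun ξ => |h (4 * Real.pi ^ 2 * ‖ξ‖ ^ 2)| * ((‖u₀‖ + 1) ^ 2 * volume.real Ω))
    ?_ ?_ ?_ ?_
  · exact Filter.Eventually.of_forall fun u =>
      ((continuous_symbol hc).mul (continuous_fourierPower ho hb u)).aestronglyMeasurable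
  · filter_upwards [Metric.ball_mem_nhds u₀ one_pos] with u hu
    refine ae_of_all _ fun ξ => ?_
    rw [norm_mul, Real.norm_eq_abs, Real.norm_of_nonneg (fourierPower_nonneg hb u ξ)]
    gcongr
    refine (fourierPower_le hb u ξ).trans ?_
    gcongr
    rw [mem_ball_iff_norm] at hu
    linarith [norm_le_norm_add_norm_sub' u u₀]
  · exact (integrable_symbol hc hz).abs.mul_const _
  · refine ae_of_all _ fun ξ => ?_
    unfold fourierPower
    fun_prop

end Symbol

/-! ### Plancherel's identity and the Fourier form inequality -/

section Plancherel

open FourierTransform LineDeriv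

variable {φ : EuclideanSpace ℝ (Fin d) → ℝ}

theorem integrable_exp_smul {f : EuclideanSpace ℝ (Fin d) → ℂ} (hf : Continuous f)
    (hs : HasCompactSupport f) (ξ : EuclideanSpace ℝ (Fin d)) :
    Integrable fun v : EuclideanSpace ℝ (Fin d) =>
      Complex.exp (↑(-2 * Real.pi * inner ℝ v ξ) * Complex.I) • f v := by
  have hc : Continuous fun v : EuclideanSpace ℝ (Fin d) =>
      Complex.exp (↑(-2 * Real.pi * inner ℝ v ξ) * Complex.I) := by fun_prop
  exact (hc.smul hf).integrable_of_hasCompactSupport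
    (hs.mono (Function.support_smul_subset_right _ f))

namespace IsTestFunction

/-- A test function as a complex Schwartz function. -/
def toSchwartz (hφ : IsTestFunction Ω φ) : SchwartzMap (EuclideanSpace ℝ (Fin d)) ℂ :=
  (hφ.2.1.comp_left Complex.ofReal_zero : HasCompactSupport (Complex.ofReal ∘ φ)).toSchwartzMap
    (Complex.ofRealCLM.contDiff.comp hφ.1)

theorem toSchwartz_apply (hφ : IsTestFunction Ω φ) (x : EuclideanSpace ℝ (Fin d)) :
    hφ.toSchwartz x = φ x := rfl

theorem integral_sq_eq (hφ : IsTestFunction Ω φ) : ∫ x, φ x ^ 2 = ‖hφ.toPair.1‖ ^ 2 := by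
  rw [← real_inner_self_eq_norm_sq, L2.inner_def,
    ← setIntegral_eq_integral_of_forall_compl_eq_zero (s := Ω) fun x hx => by
      rw [hφ.eq_zero_of_notMem hx, zero_pow two_ne_zero]]
  refine integral_congr_ae ?_
  filter_upwards [(hφ.memLp _).coeFn_toLp] with x h
  simp only [toPair]
  rw [h]
  simp [sq]

theorem integral_gradient_sq_eq (hφ : IsTestFunction Ω φ) (a : Fin d) :
    ∫ x, gradient φ x a ^ 2 = ‖component Ω a hφ.toPair.2‖ ^ 2 := by
  rw [← real_inner_self_eq_norm_sq, L2.inner_def,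
    ← setIntegral_eq_integral_of_forall_compl_eq_zero (s := Ω) fun x hx => by
      rw [hφ.gradient_eq_zero_of_notMem hx]; simp]
  refine integral_congr_ae ?_
  filter_upwards [component_coe a hφ.toPair.2, (hφ.memLp_gradient _).coeFn_toLp] with x h1 h2
  rw [h1]
  simp only [toPair]
  rw [h2]
  simp [sq]

theorem inner_wave (hφ : IsTestFunction Ω φ) (hb : Bornology.IsBounded Ω) (θ : ℝ)
    (ξ : EuclideanSpace ℝ (Fin d)) :
    inner ℝ hφ.toPair.1 (wave hb θ ξ) = ∫ x, Real.cos (2 * Real.pi * inner ℝ x ξ - θ) * φ x := by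
  have hs : ∫ x in Ω, Real.cos (2 * Real.pi * inner ℝ x ξ - θ) * φ x =
      ∫ x, Real.cos (2 * Real.pi * inner ℝ x ξ - θ) * φ x :=
    setIntegral_eq_integral_of_forall_compl_eq_zero fun x hx => by
      rw [hφ.eq_zero_of_notMem hx, mul_zero]
  rw [L2.inner_def, ← hs]
  refine integral_congr_ae ?_
  filter_upwards [(hφ.memLp _).coeFn_toLp, wave_coe hb θ ξ] with x h1 h2
  rw [h2]
  simp only [toPair]
  rw [h1]
  simp

theorem fourierPower_eq (hφ : IsTestFunction Ω φ) (hb : Bornology.IsBounded Ω)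
    (ξ : EuclideanSpace ℝ (Fin d)) :
    fourierPower hb hφ.toPair.1 ξ = ‖𝓕 hφ.toSchwartz ξ‖ ^ 2 := by
  have hi : Integrable fun v : EuclideanSpace ℝ (Fin d) =>
      Complex.exp (↑(-2 * Real.pi * inner ℝ v ξ) * Complex.I) • hφ.toSchwartz v := by
    have hs : HasCompactSupport hφ.toSchwartz := hφ.2.1.comp_left Complex.ofReal_zero
    have hc : Continuous hφ.toSchwartz := hφ.toSchwartz.continuous
    exact integrable_exp_smul hc hs ξ
  rw [SchwartzMap.fourier_coe, Real.fourier_eq', Complex.sq_norm, Complex.normSq_apply,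
    fourierPower, inner_wave, inner_wave, ← sq, ← sq]
  have hre := Complex.reCLM.integral_comp_comm hi
  have him := Complex.imCLM.integral_comp_comm hi
  simp only [Complex.reCLM_apply, Complex.imCLM_apply] at hre him
  rw [← hre, ← him]
  congr 1
  · congr 2
    ext x
    rw [toSchwartz_apply, smul_eq_mul, Complex.re_mul_ofReal, Complex.exp_ofReal_mul_I_re]
    congr 1
    rw [sub_zero, ← Real.cos_neg]
    ring_nf
  -- The imaginary part carries minus the sine; the square hides the sign.
  · rw [← neg_sq, ← integral_neg]
    congr 2
    ext x
    rw [toSchwartz_apply, smul_eq_mul, Complex.im_mul_ofReal, Complex.exp_ofReal_mul_I_im,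
      Real.cos_sub_pi_div_two, ← neg_mul, ← Real.sin_neg]
    ring_nf

theorem integral_norm_sq_fourier (hφ : IsTestFunction Ω φ) :
    ∫ ξ, ‖𝓕 hφ.toSchwartz ξ‖ ^ 2 = ‖hφ.toPair.1‖ ^ 2 := by
  rw [SchwartzMap.integral_norm_sq_fourier, ← hφ.integral_sq_eq]
  simp [toSchwartz_apply]

theorem fourier_lineDeriv_norm_sq (hφ : IsTestFunction Ω φ) (a : Fin d)
    (ξ : EuclideanSpace ℝ (Fin d)) :
    ‖𝓕 (∂_{EuclideanSpace.single a (1 : ℝ)} hφ.toSchwartz) ξ‖ ^ 2 =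
      4 * Real.pi ^ 2 * ξ a ^ 2 * ‖𝓕 hφ.toSchwartz ξ‖ ^ 2 := by
  rw [SchwartzMap.fourier_lineDerivOp_eq, smul_apply,
    SchwartzMap.smulLeftCLM_apply_apply (by fun_prop), norm_smul, norm_smul,
    EuclideanSpace.inner_single_right]
  simp [mul_pow]
  ring

theorem integral_norm_sq_fourier_lineDeriv (hφ : IsTestFunction Ω φ) (a : Fin d) :
    ∫ ξ, ‖𝓕 (∂_{EuclideanSpace.single a (1 : ℝ)} hφ.toSchwartz) ξ‖ ^ 2 =
      ‖component Ω a hφ.toPair.2‖ ^ 2 := by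
  rw [SchwartzMap.integral_norm_sq_fourier, ← hφ.integral_gradient_sq_eq]
  congr 1
  ext x
  rw [SchwartzMap.lineDerivOp_apply_eq_fderiv, gradient_apply]
  have : HasFDerivAt (hφ.toSchwartz : EuclideanSpace ℝ (Fin d) → ℂ)
      (Complex.ofRealCLM.comp (fderiv ℝ φ x)) x :=
    Complex.ofRealCLM.hasFDerivAt.comp x (hφ.differentiable x).hasFDerivAt
  rw [this.fderiv]
  simp

theorem integrable_norm_sq_schwartz (f : SchwartzMap (EuclideanSpace ℝ (Fin d)) ℂ) :
    Integrable fun ξ => ‖f ξ‖ ^ 2 :=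
  (memLp_two_iff_integrable_sq_norm f.continuous.aestronglyMeasurable).1 (f.memLp 2)

theorem four_pi_sq_mul_eq_sum (hφ : IsTestFunction Ω φ) (ξ : EuclideanSpace ℝ (Fin d)) :
    4 * Real.pi ^ 2 * ‖ξ‖ ^ 2 * ‖𝓕 hφ.toSchwartz ξ‖ ^ 2 =
      ∑ a : Fin d, ‖(𝓕 (∂_{EuclideanSpace.single a (1 : ℝ)} hφ.toSchwartz) :
        SchwartzMap (EuclideanSpace ℝ (Fin d)) ℂ) ξ‖ ^ 2 := by
  simp_rw [fourier_lineDeriv_norm_sq, EuclideanSpace.norm_sq_eq, Real.norm_eq_abs, sq_abs,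
    ← Finset.sum_mul, ← Finset.mul_sum]

theorem integrable_four_pi_sq_mul (hφ : IsTestFunction Ω φ) :
    Integrable fun ξ => 4 * Real.pi ^ 2 * ‖ξ‖ ^ 2 * ‖𝓕 hφ.toSchwartz ξ‖ ^ 2 := by
  simp_rw [four_pi_sq_mul_eq_sum]
  exact integrable_finsetSum _ fun a _ => integrable_norm_sq_schwartz _

theorem integral_four_pi_sq_mul (hφ : IsTestFunction Ω φ) :
    ∫ ξ, 4 * Real.pi ^ 2 * ‖ξ‖ ^ 2 * ‖𝓕 hφ.toSchwartz ξ‖ ^ 2 = ‖hφ.toPair.2‖ ^ 2 := by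
  simp_rw [four_pi_sq_mul_eq_sum]
  rw [integral_finsetSum _ fun a _ => integrable_norm_sq_schwartz _, norm_sq_eq_sum_component]
  simp_rw [integral_norm_sq_fourier_lineDeriv]

end IsTestFunction

/-- If `A + B t ≤ h t` on `[0, ∞)`, then the quadratic form of `A - B Δ` on `H¹₀(Ω)` is at most
that of `h(-Δ)` on the whole space. -/
theorem mul_norm_sq_add_le_integral (ho : IsOpen Ω) (hb : Bornology.IsBounded Ω)
    {h : ℝ → ℝ} {z A B : ℝ} (hc : Continuous h) (hz : ∀ t, z ≤ t → h t = 0)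
    (hAB : ∀ t, 0 ≤ t → A + B * t ≤ h t) {p : L2 Ω × L2Vec Ω} (hp : p ∈ sobolevH10 Ω) :
    A * ‖p.1‖ ^ 2 + B * ‖p.2‖ ^ 2 ≤
      ∫ ξ, h (4 * Real.pi ^ 2 * ‖ξ‖ ^ 2) * fourierPower hb p.1 ξ := by
  have hcont := continuous_integral_symbol ho hb hc hz
  refine sobolevH10_induction (P := fun p => A * ‖p.1‖ ^ 2 + B * ‖p.2‖ ^ 2 ≤
      ∫ ξ, h (4 * Real.pi ^ 2 * ‖ξ‖ ^ 2) * fourierPower hb p.1 ξ)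
    (isClosed_le (by fun_prop) (hcont.comp continuous_fst)) (fun φ hφ => ?_) hp
  have h1 := IsTestFunction.integrable_norm_sq_schwartz (𝓕 hφ.toSchwartz)
  have h2 := hφ.integrable_four_pi_sq_mul
  -- By Plancherel the left side is the integral of `(A + B · 4π²|ξ|²) |φ̂(ξ)|²`, so `hAB` applies
  -- pointwise.
  rw [← hφ.integral_norm_sq_fourier, ← hφ.integral_four_pi_sq_mul, ← integral_const_mul,
    ← integral_const_mul, ← integral_add (h1.const_mul _) (h2.const_mul _)]
  refine integral_mono ((h1.const_mul _).add (h2.const_mul _))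
    (integrable_symbol_mul_fourierPower ho hb hc hz _) fun ξ => ?_
  dsimp only
  rw [hφ.fourierPower_eq hb, ← mul_assoc, ← add_mul]
  gcongr
  exact hAB _ (by positivity)

end Plancherel

/-! ### Convexity of the Riesz function and the Berezin–Li–Yau bound -/

section RieszFunction

variable {σ z : ℝ}

/-- The function `t ↦ (z - t)_+^σ`. -/
def rieszFun (σ z t : ℝ) : ℝ := (max 0 (z - t)) ^ σ

theorem rieszFun_nonneg (t : ℝ) : 0 ≤ rieszFun σ z t :=
  Real.rpow_nonneg (le_max_left _ _) _

theorem continuous_rieszFun (hσ : 0 ≤ σ) : Continuous (rieszFun σ z) :=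
  Continuous.rpow_const (by fun_prop) fun _ => .inr hσ

theorem rieszFun_eq_zero (hσ : 0 < σ) {t : ℝ} (ht : z ≤ t) : rieszFun σ z t = 0 := by
  rw [rieszFun, max_eq_left (by linarith), Real.zero_rpow hσ.ne']

/-- Bernoulli's inequality for `y / x`, rescaled: a convex power lies above its tangent at `x`. -/
theorem rpow_add_mul_sub_le_rpow (hσ : 1 ≤ σ) {x y : ℝ} (hx : 0 < x) (hy : 0 ≤ y) :
    x ^ σ + σ * x ^ (σ - 1) * (y - x) ≤ y ^ σ := by
  have h := one_add_mul_self_le_rpow_one_add (s := y / x - 1)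
    (by linarith [div_nonneg hy hx.le]) hσ
  have e : y ^ σ = x ^ σ * (1 + (y / x - 1)) ^ σ := by
    rw [← Real.mul_rpow hx.le (by linarith [div_nonneg hy hx.le])]
    congr 1
    field_simp
    ring
  have e2 : x ^ (σ - 1) = x ^ σ / x := Real.rpow_sub_one hx.ne' σ
  rw [e, e2]
  refine le_trans (le_of_eq ?_) (mul_le_mul_of_nonneg_left h (Real.rpow_nonneg hx.le σ))
  field_simp

theorem rieszFun_tangent_le (hσ : 1 ≤ σ) {μ : ℝ} (hμ : μ < z) (t : ℝ) :
    rieszFun σ z μ - σ * (z - μ) ^ (σ - 1) * (t - μ) ≤ rieszFun σ z t := by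
  have h := rpow_add_mul_sub_le_rpow hσ (sub_pos.2 hμ) (le_max_left 0 (z - t))
  have h2 : z - t ≤ max 0 (z - t) := le_max_right _ _
  have h3 : 0 ≤ σ * (z - μ) ^ (σ - 1) :=
    mul_nonneg (by linarith) (Real.rpow_nonneg (sub_pos.2 hμ).le _)
  rw [rieszFun, max_eq_right (sub_pos.2 hμ).le]
  refine le_trans ?_ h
  nlinarith

end RieszFunction

theorem mem_eigenspace_iff {μ : ℝ} {u : L2 Ω} : u ∈ eigenspace Ω μ ↔ ∃ g, (u, g) ∈ sobolevH10 Ω ∧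
    ∀ q ∈ sobolevH10 Ω, inner ℝ g q.2 = μ * inner ℝ u q.1 := Iff.rfl

/-- Jensen's inequality. The tangent to `t ↦ (z - t)_+^σ` at `μ` lies below the function, and its
quadratic form at `u` is exactly its value at `μ`, because `‖u‖² = 1` and `‖∇u‖² = μ`. -/
theorem rieszFun_le_integral (ho : IsOpen Ω) (hb : Bornology.IsBounded Ω) {σ z μ : ℝ}
    (hσ : 1 ≤ σ) {u : L2 Ω} (hu : u ∈ eigenspace Ω μ) (hu1 : ‖u‖ = 1) :
    rieszFun σ z μ ≤
      ∫ ξ, rieszFun σ z (4 * Real.pi ^ 2 * ‖ξ‖ ^ 2) * fourierPower hb u ξ := by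
  rcases lt_or_ge μ z with hμ | hμ
  · obtain ⟨g, hg, h⟩ := mem_eigenspace_iff.1 hu
    have hgn : ‖g‖ ^ 2 = μ := by
      have := h _ hg
      rwa [real_inner_self_eq_norm_sq, real_inner_self_eq_norm_sq, hu1, one_pow, mul_one] at this
    have := mul_norm_sq_add_le_integral ho hb (continuous_rieszFun (σ := σ) (z := z) (by linarith))
      (fun t ht => rieszFun_eq_zero (by linarith) ht)
      (A := rieszFun σ z μ + σ * (z - μ) ^ (σ - 1) * μ) (B := -(σ * (z - μ) ^ (σ - 1)))
      (fun t _ => by linarith [rieszFun_tangent_le hσ hμ t]) hg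
    rw [hgn, hu1] at this
    linarith
  · rw [rieszFun_eq_zero (by linarith) hμ]
    exact integral_nonneg fun ξ => mul_nonneg (rieszFun_nonneg _) (fourierPower_nonneg hb u ξ)

theorem sum_rieszFun_le_integral (ho : IsOpen Ω) (hb : Bornology.IsBounded Ω) {σ z : ℝ}
    (hσ : 1 ≤ σ) {ι : Type*} {u : ι → L2 Ω} {μ : ι → ℝ} (hu : Orthonormal ℝ u)
    (hμ : ∀ i, u i ∈ eigenspace Ω (μ i)) (s : Finset ι) :
    ∑ i ∈ s, rieszFun σ z (μ i) ≤ volume.real Ω *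
      ∫ ξ : EuclideanSpace ℝ (Fin d), rieszFun σ z (4 * Real.pi ^ 2 * ‖ξ‖ ^ 2) := by
  have hc : Continuous (rieszFun σ z) := continuous_rieszFun (by linarith)
  have hz : ∀ t, z ≤ t → rieszFun σ z t = 0 := fun t ht => rieszFun_eq_zero (by linarith) ht
  calc ∑ i ∈ s, rieszFun σ z (μ i)
      ≤ ∑ i ∈ s, ∫ ξ, rieszFun σ z (4 * Real.pi ^ 2 * ‖ξ‖ ^ 2) * fourierPower hb (u i) ξ :=
        Finset.sum_le_sum fun i _ => rieszFun_le_integral ho hb hσ (hμ i) (hu.norm_eq_one i)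
    _ = ∫ ξ, ∑ i ∈ s, rieszFun σ z (4 * Real.pi ^ 2 * ‖ξ‖ ^ 2) * fourierPower hb (u i) ξ :=
        (integral_finsetSum _ fun i _ => integrable_symbol_mul_fourierPower ho hb hc hz _).symm
    _ ≤ ∫ ξ : EuclideanSpace ℝ (Fin d),
          volume.real Ω * rieszFun σ z (4 * Real.pi ^ 2 * ‖ξ‖ ^ 2) := by
        refine integral_mono
          (integrable_finsetSum _ fun i _ => integrable_symbol_mul_fourierPower ho hb hc hz _)
          ((integrable_symbol hc hz).const_mul _) fun ξ => ?_
        dsimp only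
        rw [← Finset.mul_sum, mul_comm]
        exact mul_le_mul_of_nonneg_right (sum_fourierPower_le hb hu s ξ) (rieszFun_nonneg _)
    _ = _ := integral_const_mul _ _

/-! ### Evaluation of the classical constant -/

section Constant

/-- The integrand is an unnormalised Beta density, so the integral is read off from its total mass
one. -/
theorem integral_rpow_mul_rieszFun_one {a σ : ℝ} (ha : 0 < a) (hσ : 0 < σ) :
    ∫ s in Set.Ioi (0 : ℝ), s ^ (a - 1) * rieszFun σ 1 s =
      Real.Gamma a * Real.Gamma (σ + 1) / Real.Gamma (a + (σ + 1)) := by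
  have hB := ProbabilityTheory.beta_pos ha (show 0 < σ + 1 by linarith)
  have h1 : ∫ s, ProbabilityTheory.betaPDFReal a (σ + 1) s = 1 := by
    rw [integral_eq_lintegral_of_nonneg_ae _
      (ProbabilityTheory.measurable_betaPDFReal a (σ + 1)).aestronglyMeasurable]
    · have := ProbabilityTheory.lintegral_betaPDF_eq_one ha (show 0 < σ + 1 by linarith)
      simp only [ProbabilityTheory.betaPDF] at this
      rw [this]; rfl
    · refine ae_of_all _ fun s => ?_
      by_cases hs : 0 < s ∧ s < 1
      · exact (ProbabilityTheory.betaPDFReal_pos hs.1 hs.2 ha (by linarith)).le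
      · simp [ProbabilityTheory.betaPDFReal, hs]
  have h2 : ∀ s, (Set.Ioi (0 : ℝ)).indicator (fun s => s ^ (a - 1) * rieszFun σ 1 s) s =
      ProbabilityTheory.beta a (σ + 1) * ProbabilityTheory.betaPDFReal a (σ + 1) s := by
    intro s
    by_cases hs : 0 < s
    · rw [Set.indicator_of_mem (show s ∈ Set.Ioi (0 : ℝ) from hs)]
      by_cases hs1 : s < 1
      · rw [ProbabilityTheory.betaPDFReal, if_pos ⟨hs, hs1⟩, rieszFun,
          max_eq_right (by linarith), add_sub_cancel_right]
        field_simp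
      · rw [rieszFun_eq_zero hσ (not_lt.1 hs1), ProbabilityTheory.betaPDFReal,
          if_neg (fun h => hs1 h.2), mul_zero, mul_zero]
    · rw [Set.indicator_of_notMem (show s ∉ Set.Ioi (0 : ℝ) from hs),
        ProbabilityTheory.betaPDFReal, if_neg (fun h => hs h.1), mul_zero]
  rw [← integral_indicator measurableSet_Ioi]
  simp_rw [h2]
  rw [integral_const_mul, h1, mul_one, ProbabilityTheory.beta]

theorem integral_rpow_mul_rieszFun {a σ z c : ℝ} (ha : 0 < a) (hσ : 0 < σ) (hz : 0 < z)
    (hc : 0 < c) :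
    ∫ t in Set.Ioi (0 : ℝ), t ^ (a - 1) * rieszFun σ z (c * t) =
      (z / c) ^ a * z ^ σ *
        (Real.Gamma a * Real.Gamma (σ + 1) / Real.Gamma (a + (σ + 1))) := by
  have hzc : 0 < z / c := div_pos hz hc
  rw [← integral_rpow_mul_rieszFun_one ha hσ, ← integral_const_mul]
  have h := integral_comp_mul_left_Ioi
    (fun t => t ^ (a - 1) * rieszFun σ z (c * t)) 0 hzc
  rw [mul_zero, smul_eq_mul, eq_comm, inv_mul_eq_iff_eq_mul₀ hzc.ne', ← integral_const_mul] at h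
  rw [h]
  refine setIntegral_congr_fun measurableSet_Ioi fun s hs => ?_
  have hs : 0 < s := hs
  have e1 : rieszFun σ z (c * (z / c * s)) = z ^ σ * rieszFun σ 1 s := by
    rw [rieszFun, rieszFun, ← Real.mul_rpow hz.le (le_max_left _ _)]
    congr 1
    rw [mul_max_of_nonneg _ _ hz.le]
    congr 1
    · simp
    · field_simp
  rw [e1, Real.mul_rpow hzc.le hs.le, Real.rpow_sub_one hzc.ne']
  field_simp

/-- Polar coordinates, then the substitution `t = r²`, reduce this to the Beta integral with first
parameter `d/2`. -/
theorem integral_rieszFun_symbol (hd : 1 ≤ d) {σ z : ℝ} (hσ : 0 < σ) (hz : 0 < z) :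
    ∫ ξ : EuclideanSpace ℝ (Fin d), rieszFun σ z (4 * Real.pi ^ 2 * ‖ξ‖ ^ 2) =
      classicalConst σ d * z ^ (σ + (d : ℝ) / 2) := by
  have hd0 : 0 < (d : ℝ) := by exact_mod_cast hd
  have : Nonempty (Fin d) := ⟨⟨0, hd⟩⟩
  have hpi := Real.pi_pos
  rw [integral_fun_norm_addHaar volume (fun y => rieszFun σ z (4 * Real.pi ^ 2 * y ^ 2))]
  have hrad : ∫ y in Set.Ioi (0 : ℝ), y ^ (d - 1) • rieszFun σ z (4 * Real.pi ^ 2 * y ^ 2) =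
      1 / 2 * ∫ t in Set.Ioi (0 : ℝ),
        t ^ ((d : ℝ) / 2 - 1) * rieszFun σ z (4 * Real.pi ^ 2 * t) := by
    rw [← integral_comp_rpow_Ioi (fun t : ℝ =>
      t ^ ((d : ℝ) / 2 - 1) * rieszFun σ z (4 * Real.pi ^ 2 * t)) (two_ne_zero' ℝ),
      ← integral_const_mul]
    refine setIntegral_congr_fun measurableSet_Ioi fun y hy => ?_
    have hy : 0 < y := hy
    have e : (y ^ (2 : ℝ)) ^ ((d : ℝ) / 2 - 1) * y = y ^ (d - 1) := by
      rw [← Real.rpow_mul hy.le, ← Real.rpow_add_one hy.ne', ← Real.rpow_natCast,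
        Nat.cast_sub hd]
      congr 1
      push_cast
      ring
    rw [← e, smul_eq_mul, smul_eq_mul, Real.rpow_two, abs_two]
    norm_num
    ring
  rw [finrank_euclideanSpace_fin, hrad, integral_rpow_mul_rieszFun (by positivity) hσ hz
    (by positivity), Measure.real, EuclideanSpace.volume_ball]
  simp only [nsmul_eq_mul, smul_eq_mul, ENNReal.ofReal_one, one_pow, one_mul, Fintype.card_fin]
  rw [ENNReal.toReal_ofReal (by positivity), Real.Gamma_add_one (by positivity), classicalConst,
    Real.rpow_add hz, Real.div_rpow hz.le (by positivity), Real.sqrt_eq_rpow,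
    ← Real.rpow_mul_natCast hpi.le]
  have e1 : (4 * Real.pi ^ 2) ^ ((d : ℝ) / 2) =
      (4 * Real.pi) ^ ((d : ℝ) / 2) * Real.pi ^ ((d : ℝ) / 2) := by
    rw [← Real.mul_rpow (by positivity) hpi.le]
    congr 1
    ring
  rw [e1, show (1 : ℝ) / 2 * d = d / 2 by ring,
    show (d : ℝ) / 2 + (σ + 1) = σ + 1 + d / 2 by ring]
  have g1 := (Real.Gamma_pos_of_pos (show 0 < (d : ℝ) / 2 by positivity)).ne'
  have g2 := (Real.Gamma_pos_of_pos (show 0 < σ + 1 + (d : ℝ) / 2 by positivity)).ne'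
  have p1 := (Real.rpow_pos_of_pos hpi ((d : ℝ) / 2)).ne'
  have p2 := (Real.rpow_pos_of_pos (show 0 < 4 * Real.pi by positivity) ((d : ℝ) / 2)).ne'
  field_simp

end Constant

/-- The Berezin–Li–Yau inequality for finitely many orthonormal eigenfunctions. -/
theorem sum_rieszFun_le (hd : 1 ≤ d) (ho : IsOpen Ω) (hb : Bornology.IsBounded Ω) {σ z : ℝ}
    (hσ : 1 ≤ σ) (hz : 0 < z) {ι : Type*} {u : ι → L2 Ω} {μ : ι → ℝ} (hu : Orthonormal ℝ u)
    (hμ : ∀ i, u i ∈ eigenspace Ω (μ i)) (s : Finset ι) :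
    ∑ i ∈ s, rieszFun σ z (μ i) ≤ classicalConst σ d * volume.real Ω * z ^ (σ + (d : ℝ) / 2) := by
  refine (sum_rieszFun_le_integral ho hb hσ hu hμ s).trans (le_of_eq ?_)
  rw [integral_rieszFun_symbol hd (by linarith) hz]
  ring

end Dirichlet

/-! ### Compactness criteria and the spectral theorem for closed forms -/

/-- A bounded operator that is small on subspaces of finite codimension is compact. -/
theorem ContinuousLinearMap.isCompactOperator_of_small_on_finite_codim {E F : Type*}
    [NormedAddCommGroup E] [InnerProductSpace ℝ E] [NormedAddCommGroup F] [NormedSpace ℝ F]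
    [CompleteSpace F] (T : E →L[ℝ] F)
    (h : ∀ ε > 0, ∃ s : Set E, s.Finite ∧
      ∀ x, (∀ y ∈ s, inner ℝ y x = 0) → ‖T x‖ ≤ ε * ‖x‖) : IsCompactOperator T := by
  have hcl := isClosed_setOfPred_isCompactOperator (σ₁₂ := RingHom.id ℝ) (M₁ := E) (M₂ := F)
  refine hcl.closure_subset (Metric.mem_closure_iff.2 fun ε hε => ?_)
  obtain ⟨s, hs, hT⟩ := h (ε / 2) (half_pos hε)
  let V := Submodule.span ℝ s
  have : FiniteDimensional ℝ V := FiniteDimensional.span_of_finite ℝ hs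
  -- The finite-rank approximant is `T` after orthogonal projection onto the span of `s`; the error
  -- sees only vectors orthogonal to `s`.
  refine ⟨(T ∘L V.subtypeL) ∘L V.orthogonalProjectionOnto,
    (isCompactOperator_of_locallyCompactSpace_rng (T ∘L V.subtypeL)).comp_clm _, ?_⟩
  rw [dist_eq_norm]
  refine lt_of_le_of_lt (ContinuousLinearMap.opNorm_le_bound _ (half_pos hε).le fun x => ?_)
    (half_lt_self hε)
  have hx : x - V.orthogonalProjectionOnto x ∈ Vᗮ :=
    Submodule.sub_starProjection_mem_orthogonal x
  have h1 : ‖T (x - V.orthogonalProjectionOnto x)‖ ≤ ε / 2 * ‖x - V.orthogonalProjectionOnto x‖ :=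
    hT _ fun y hy => hx y (Submodule.subset_span hy)
  have h2 : ‖x - V.orthogonalProjectionOnto x‖ ≤ ‖x‖ := by
    have h3 : inner ℝ (V.orthogonalProjectionOnto x : E) (x - V.orthogonalProjectionOnto x) = 0 :=
      hx _ (V.orthogonalProjectionOnto x).2
    have h4 := norm_add_sq_real (V.orthogonalProjectionOnto x : E) (x - V.orthogonalProjectionOnto x)
    rw [h3, add_sub_cancel] at h4
    refine (sq_le_sq₀ (norm_nonneg _) (norm_nonneg _)).1 ?_
    nlinarith [sq_nonneg ‖(V.orthogonalProjectionOnto x : E)‖]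
  calc _ = ‖T (x - V.orthogonalProjectionOnto x)‖ := by simp
    _ ≤ ε / 2 * ‖x - V.orthogonalProjectionOnto x‖ := h1
    _ ≤ ε / 2 * ‖x‖ := by gcongr

/-- A bounded operator `T` such that `‖T x‖ ≤ ε ‖x‖` once `T x` is orthogonal to finitely many
vectors, depending on `ε`, is compact. -/
theorem ContinuousLinearMap.isCompactOperator_of_small_on_kernels {E F : Type*}
    [NormedAddCommGroup E] [InnerProductSpace ℝ E] [CompleteSpace E]
    [NormedAddCommGroup F] [InnerProductSpace ℝ F] [CompleteSpace F] (T : E →L[ℝ] F)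
    (h : ∀ ε > 0, ∃ s : Set F, s.Finite ∧
      ∀ x, (∀ y ∈ s, inner ℝ y (T x) = 0) → ‖T x‖ ≤ ε * ‖x‖) : IsCompactOperator T := by
  refine T.isCompactOperator_of_small_on_finite_codim fun ε hε => ?_
  obtain ⟨s, hs, hT⟩ := h ε hε
  refine ⟨T.adjoint '' s, hs.image _, fun x hx => hT x fun y hy => ?_⟩
  rw [← ContinuousLinearMap.adjoint_inner_left]
  exact hx _ ⟨y, hy, rfl⟩

namespace FormSpectrum

variable {A B : Type*} [NormedAddCommGroup A] [InnerProductSpace ℝ A]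
  [NormedAddCommGroup B] [InnerProductSpace ℝ B] {K : Submodule ℝ (A × B)}

/-- A subspace of `A × B` with the inner product of the Hilbert sum `A ⊕ B`. -/
def graphSpace (K : Submodule ℝ (A × B)) : Submodule ℝ (WithLp 2 (A × B)) :=
  K.comap (WithLp.prodContinuousLinearEquiv 2 ℝ A B).toLinearMap

theorem mem_graphSpace {p : WithLp 2 (A × B)} : p ∈ graphSpace K ↔ (p.fst, p.snd) ∈ K := Iff.rfl

/-- The first projection on a subspace of the Hilbert sum `A ⊕ B`. -/
def embedding (K : Submodule ℝ (A × B)) : graphSpace K →L[ℝ] A :=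
  (WithLp.fstL 2 ℝ A B) ∘L (graphSpace K).subtypeL

theorem norm_sq_graphSpace (p : graphSpace K) : ‖p‖ ^ 2 = ‖p.1.fst‖ ^ 2 + ‖p.1.snd‖ ^ 2 :=
  WithLp.prod_norm_sq_eq_of_L2 p.1

variable [CompleteSpace A] [CompleteSpace B]

theorem completeSpace_graphSpace (hK : IsClosed (K : Set (A × B))) :
    CompleteSpace (graphSpace K) :=
  IsClosed.completeSpace_coe (s := (graphSpace K : Set (WithLp 2 (A × B))))
    (hs := hK.preimage (WithLp.prodContinuousLinearEquiv 2 ℝ A B).continuous)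

theorem isCompactOperator_embedding (hK : IsClosed (K : Set (A × B)))
    (h : ∀ z : ℝ, ∃ s : Set A, s.Finite ∧ ∀ p ∈ K, (∀ y ∈ s, inner ℝ y p.1 = 0) →
      z * ‖p.1‖ ^ 2 ≤ ‖p.1‖ ^ 2 + ‖p.2‖ ^ 2) : IsCompactOperator (embedding K) := by
  have := completeSpace_graphSpace hK
  refine (embedding K).isCompactOperator_of_small_on_kernels fun ε hε => ?_
  -- With `z = ε⁻²` the hypothesis reads `‖p.1‖² ≤ ε² ‖p‖²` in the graph norm.
  obtain ⟨s, hs, h⟩ := h (ε ^ 2)⁻¹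
  refine ⟨s, hs, fun p hp => ?_⟩
  have := h _ (mem_graphSpace.1 p.2) hp
  rw [← norm_sq_graphSpace, inv_mul_le_iff₀ (by positivity), ← mul_pow] at this
  exact (sq_le_sq₀ (norm_nonneg _) (by positivity)).1 this

/-- Completeness of the eigenvectors of the form `⟪g, g⟫` on pairs `(u, g) ∈ K`, if `K` is closed,
densely projects to `A`, and the projection is compact. -/
theorem eq_zero_of_forall_eigenvector (hK : IsClosed (K : Set (A × B)))
    (h : ∀ z : ℝ, ∃ s : Set A, s.Finite ∧ ∀ p ∈ K, (∀ y ∈ s, inner ℝ y p.1 = 0) →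
      z * ‖p.1‖ ^ 2 ≤ ‖p.1‖ ^ 2 + ‖p.2‖ ^ 2)
    (hdense : ∀ f : A, (∀ p ∈ K, inner ℝ f p.1 = 0) → f = 0) {f : A}
    (hf : ∀ (μ : ℝ) (u : A) (g : B), (u, g) ∈ K →
      (∀ q ∈ K, inner ℝ g q.2 = μ * inner ℝ u q.1) → inner ℝ u f = 0) : f = 0 := by
  have := completeSpace_graphSpace hK
  -- For the Dirichlet form this is the resolvent `(1 - Δ)⁻¹`: compact, self-adjoint and positive.
  let S : A →L[ℝ] A := embedding K ∘L (embedding K).adjoint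
  have hS : IsCompactOperator S := (isCompactOperator_embedding hK h).comp_clm _
  have hsymm : S.IsSymmetric :=
    (ContinuousLinearMap.isPositive_self_comp_adjoint (embedding K)).isSymmetric
  rw [← Submodule.mem_bot ℝ, ← S.orthogonalComplement_iSup_eigenspaces_eq_bot hS hsymm,
    ← Submodule.iInf_orthogonal, Submodule.mem_iInf]
  intro ν u hu
  rw [Module.End.mem_eigenspace_iff] at hu
  set p := (embedding K).adjoint u with hp
  have hpu : p.1.fst = ν • u := hu
  -- The adjoint relation is the weak equation for `p`, in which `p.1.fst = ν u`.
  have hq : ∀ q ∈ K, ν * inner ℝ u q.1 + inner ℝ p.1.snd q.2 = inner ℝ u q.1 := by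
    intro q hq
    have h := ContinuousLinearMap.adjoint_inner_left (embedding K)
      (⟨WithLp.toLp 2 q, hq⟩ : graphSpace K) u
    rw [← hp, Submodule.coe_inner, WithLp.prod_inner_apply] at h
    change inner ℝ p.1.fst q.1 + inner ℝ p.1.snd q.2 = inner ℝ u q.1 at h
    rwa [hpu, real_inner_smul_left] at h
  by_cases hν : ν = 0
  -- For `ν = 0`, testing against `p` itself forces `p = 0`; then `u` is orthogonal to the dense
  -- projection of `K`.
  · have h1 := hq _ (mem_graphSpace.1 p.2)
    rw [hpu, hν, zero_smul, inner_zero_right, mul_zero, zero_add,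
      real_inner_self_eq_norm_sq] at h1
    have h2 : p.1.snd = 0 := by simpa using h1
    have : u = 0 := hdense u fun q hqm => by
      have := hq q hqm
      rw [hν, h2, inner_zero_left] at this
      linarith
    rw [this, inner_zero_left]
  -- Dividing the weak equation by `ν` gives the form eigenvalue `1/ν - 1`.
  · refine hf (1 / ν - 1) u (ν⁻¹ • p.1.snd) ?_ ?_
    · have := K.smul_mem ν⁻¹ (mem_graphSpace.1 p.2)
      rwa [Prod.smul_mk, hpu, smul_smul, inv_mul_cancel₀ hν, one_smul] at this
    · intro q hqm
      rw [real_inner_smul_left, ← sub_eq_iff_eq_add'.2 (hq q hqm).symm]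
      field_simp

end FormSpectrum

/-! ### Compactness and discreteness for the Dirichlet Laplacian -/

namespace Dirichlet

variable {d : ℕ} {Ω : Set (EuclideanSpace ℝ (Fin d))}

/-- A finite-codimension form of Rellich's theorem. If `u` is orthogonal to the waves at a fine net
of frequencies, `û` is small on the ball of radius `√z`, and the Fourier form inequality with symbol
`(z - t)_+` bounds `z‖u‖² - ‖∇u‖²` by `‖u‖²`. -/
theorem exists_finite_forall_inner_eq_zero (ho : IsOpen Ω) (hb : Bornology.IsBounded Ω) (z : ℝ) :
    ∃ s : Set (L2 Ω), s.Finite ∧ ∀ p ∈ sobolevH10 Ω, (∀ y ∈ s, inner ℝ y p.1 = 0) →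
      z * ‖p.1‖ ^ 2 ≤ ‖p.1‖ ^ 2 + ‖p.2‖ ^ 2 := by
  obtain ⟨C, hC0, hC⟩ := exists_norm_wave_sub_le ho hb
  set M : ℝ := ∫ ξ : EuclideanSpace ℝ (Fin d), rieszFun 1 z (4 * Real.pi ^ 2 * ‖ξ‖ ^ 2) with hM
  have hM0 : 0 ≤ M := integral_nonneg fun ξ => rieszFun_nonneg _
  have hcont : Continuous (rieszFun 1 z) := continuous_rieszFun zero_le_one
  have hzero : ∀ t, z ≤ t → rieszFun 1 z t = 0 := fun t ht => rieszFun_eq_zero one_pos ht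
  -- The mesh `δ` makes the Fourier power at most `2(Cδ)²‖u‖²` on the ball, so that its integral
  -- against the symbol of mass `M` is at most `‖u‖²`.
  obtain ⟨δ, hδ, hδM⟩ : ∃ δ > 0, M * (2 * (C * δ) ^ 2) ≤ 1 := by
    refine ⟨1 / √(2 * M * C ^ 2 + 1), by positivity, ?_⟩
    rw [mul_pow, div_pow, Real.sq_sqrt (by positivity), one_pow]
    have : 0 < 2 * M * C ^ 2 + 1 := by positivity
    have e : M * (2 * (C ^ 2 * (1 / (2 * M * C ^ 2 + 1)))) =
        (2 * M * C ^ 2) / (2 * M * C ^ 2 + 1) := by ring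
    rw [e, div_le_one this]
    linarith
  obtain ⟨t, -, htf, ht⟩ :=
    (isCompact_closedBall (0 : EuclideanSpace ℝ (Fin d)) √z).finite_cover_balls hδ
  refine ⟨wave hb 0 '' t ∪ wave hb (Real.pi / 2) '' t, (htf.image _).union (htf.image _), ?_⟩
  rintro ⟨u, g⟩ hp hs
  dsimp only at hs ⊢
  have hw : ∀ θ, (∀ ξ ∈ t, inner ℝ u (wave hb θ ξ) = 0) → ∀ ξ, ‖ξ‖ ≤ √z →
      inner ℝ u (wave hb θ ξ) ^ 2 ≤ (C * δ) ^ 2 * ‖u‖ ^ 2 := by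
    intro θ h ξ hξ
    obtain ⟨η, hη, hξη⟩ : ∃ η ∈ t, ξ ∈ Metric.ball η δ := by
      simpa using ht (show ξ ∈ Metric.closedBall 0 √z by simpa using hξ)
    have e : inner ℝ u (wave hb θ ξ) = inner ℝ u (wave hb θ ξ - wave hb θ η) := by
      rw [inner_sub_right, h η hη, sub_zero]
    rw [e, ← sq_abs, ← mul_pow, mul_comm (C * δ)]
    gcongr
    refine (abs_real_inner_le_norm _ _).trans ?_
    gcongr
    refine (hC θ ξ η).trans ?_
    gcongr
    exact (mem_ball_iff_norm.1 hξη).le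
  have h0 := hw 0 fun ξ hξ => by
    rw [real_inner_comm]; exact hs _ (.inl ⟨ξ, hξ, rfl⟩)
  have h1 := hw (Real.pi / 2) fun ξ hξ => by
    rw [real_inner_comm]; exact hs _ (.inr ⟨ξ, hξ, rfl⟩)
  have key := mul_norm_sq_add_le_integral ho hb hcont hzero (A := z) (B := -1)
    (fun t _ => by
      rw [rieszFun, Real.rpow_one]
      linarith [le_max_right 0 (z - t)]) hp
  have hint : ∫ ξ, rieszFun 1 z (4 * Real.pi ^ 2 * ‖ξ‖ ^ 2) * fourierPower hb u ξ ≤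
      M * (2 * (C * δ) ^ 2 * ‖u‖ ^ 2) := by
    rw [hM, ← integral_mul_const]
    refine integral_mono (integrable_symbol_mul_fourierPower ho hb hcont hzero u)
      ((integrable_symbol hcont hzero).mul_const _) fun ξ => ?_
    dsimp only
    rcases le_total ‖ξ‖ √z with hξ | hξ
    · refine mul_le_mul_of_nonneg_left ?_ (rieszFun_nonneg _)
      unfold fourierPower
      linarith [h0 ξ hξ, h1 ξ hξ]
    · rw [hzero _ (le_four_pi_sq_mul_norm_sq hξ), zero_mul, zero_mul]
  dsimp only at key
  have := mul_le_mul_of_nonneg_right hδM (sq_nonneg ‖u‖)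
  nlinarith

theorem inner_eq_zero_of_mem_eigenspace {μ ν : ℝ} (hμν : μ ≠ ν) {u v : L2 Ω}
    (hu : u ∈ eigenspace Ω μ) (hv : v ∈ eigenspace Ω ν) : inner ℝ u v = 0 := by
  obtain ⟨g, hg, h1⟩ := mem_eigenspace_iff.1 hu
  obtain ⟨k, hk, h2⟩ := mem_eigenspace_iff.1 hv
  have e1 := h1 _ hk
  have e2 := h2 _ hg
  rw [real_inner_comm, real_inner_comm u v] at e2
  have : (μ - ν) * inner ℝ u v = 0 := by linarith
  exact (mul_eq_zero.1 this).resolve_left (sub_ne_zero.2 hμν)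

/-- Testing with `u` itself gives `‖∇u‖² = μ‖u‖² ≤ 0`. Then `∇u = 0`, and the commutation identity
for one coordinate, available since `d ≥ 1`, forces `u = 0`. -/
theorem eigenspace_eq_bot (hd : 1 ≤ d) (ho : IsOpen Ω) (hb : Bornology.IsBounded Ω) {μ : ℝ}
    (hμ : μ ≤ 0) : eigenspace Ω μ = ⊥ := by
  refine (Submodule.eq_bot_iff _).2 fun u hu => ?_
  obtain ⟨g, hg, h⟩ := mem_eigenspace_iff.1 hu
  have h1 := h _ hg
  rw [real_inner_self_eq_norm_sq, real_inner_self_eq_norm_sq] at h1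
  have hg0 : g = 0 := by
    have : ‖g‖ ^ 2 = 0 := le_antisymm (by nlinarith [sq_nonneg ‖u‖]) (sq_nonneg _)
    simpa using this
  have h2 := norm_sq_eq_neg_two_mul_inner ho hb ⟨0, hd⟩ hg
  simpa [hg0] using h2

/-- The eigenfunctions of the Dirichlet Laplacian are complete in `L²(Ω)`. -/
theorem eq_zero_of_forall_eigenspace (ho : IsOpen Ω) (hb : Bornology.IsBounded Ω) {f : L2 Ω}
    (hf : ∀ μ, ∀ u ∈ eigenspace Ω μ, inner ℝ u f = 0) : f = 0 :=
  FormSpectrum.eq_zero_of_forall_eigenvector (Submodule.isClosed_topologicalClosure (testGraph Ω))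
    (exists_finite_forall_inner_eq_zero ho hb)
    (fun _ h => eq_zero_of_forall_inner_eq_zero ho h)
    fun μ u g hg h => hf μ u ⟨g, hg, h⟩

/-- Each eigenvalue at most `z` contributes at least 1 to the first Riesz mean at `max z 0 + 1`,
which Berezin–Li–Yau bounds. -/
theorem finite_setOf_le (hd : 1 ≤ d) (ho : IsOpen Ω) (hb : Bornology.IsBounded Ω)
    {ι : Type*} {u : ι → L2 Ω} {μ : ι → ℝ} (hu : Orthonormal ℝ u)
    (hμ : ∀ i, u i ∈ eigenspace Ω (μ i)) (z : ℝ) : {i | μ i ≤ z}.Finite := by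
  by_contra hinf
  set K := classicalConst 1 d * volume.real Ω * (max z 0 + 1) ^ (1 + (d : ℝ) / 2)
  obtain ⟨n, hn⟩ := exists_nat_gt K
  obtain ⟨s, hs, hsc⟩ := Set.Infinite.exists_subset_card_eq hinf n
  have h := sum_rieszFun_le hd ho hb le_rfl (z := max z 0 + 1) (by positivity) hu hμ s
  have h2 : (n : ℝ) ≤ ∑ i ∈ s, rieszFun 1 (max z 0 + 1) (μ i) := by
    rw [← hsc, ← nsmul_one]
    refine Finset.card_nsmul_le_sum _ _ _ fun i hi => ?_
    have : μ i ≤ z := hs hi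
    rw [rieszFun, Real.rpow_one]
    exact le_max_of_le_right (by linarith [le_max_left z 0])
  linarith

/-- Otherwise Gram–Schmidt gives infinitely many orthonormal eigenfunctions with one eigenvalue,
against local finiteness. -/
theorem finiteDimensional_eigenspace (hd : 1 ≤ d) (ho : IsOpen Ω) (hb : Bornology.IsBounded Ω)
    (μ : ℝ) : FiniteDimensional ℝ (eigenspace Ω μ) := by
  by_contra hinf
  let b := Module.Free.chooseBasis ℝ (eigenspace Ω μ)
  have : Infinite (Module.Free.ChooseBasisIndex ℝ (eigenspace Ω μ)) := by
    refine not_finite_iff_infinite.1 fun hfin => hinf ?_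
    exact Module.Finite.of_basis b
  have hli : LinearIndependent ℝ (b ∘ Infinite.natEmbedding _) :=
    b.linearIndependent.comp _ (Infinite.natEmbedding _).injective
  have hon := InnerProductSpace.gramSchmidtNormed_orthonormal (𝕜 := ℝ) hli
  have hfin := finite_setOf_le hd ho hb (hon.comp_linearIsometry (eigenspace Ω μ).subtypeₗᵢ)
    (μ := fun _ => μ) (fun i => Subtype.property _) μ
  simp only [le_refl, Set.ofPred_true] at hfin
  exact Set.infinite_univ hfin

end Dirichlet

/-- Ties are broken by an auxiliary linear order. Counting predecessors is then an injective rank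
into `ℕ`, and its infinite range is order isomorphic to `ℕ`. -/
theorem exists_monotone_enumeration {ι : Type*} [Infinite ι] (e : ι → ℝ)
    (h : ∀ z, {i | e i ≤ z}.Finite) : ∃ f : ℕ ≃ ι, Monotone (e ∘ f) := by
  classical
  let : LinearOrder ι := linearOrderOfSTO WellOrderingRel
  let key : ι → ℝ ×ₗ ι := fun i => toLex (e i, i)
  have hkey : ∀ {i j}, key i ≤ key j → e i ≤ e j := fun hij => by
    rcases Prod.Lex.toLex_le_toLex.1 hij with h | h
    exacts [h.le, h.1.le]
  have hfin : ∀ i, {j | key j < key i}.Finite := fun i =>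
    (h (e i)).subset fun j hj => hkey (le_of_lt hj)
  let rank : ι → ℕ := fun i => {j | key j < key i}.ncard
  have hrank : ∀ {i j}, key i < key j → rank i < rank j := fun {i j} hij =>
    Set.ncard_lt_ncard
      ⟨fun k hk => lt_trans hk hij, fun hsub => lt_irrefl (key i) (hsub hij)⟩ (hfin j)
  have hle : ∀ {i j}, rank i ≤ rank j → key i ≤ key j := fun hij =>
    not_lt.1 fun hlt => absurd (hrank hlt) (not_lt.2 hij)
  have hinj : Function.Injective rank := fun i j hij => by
    have := le_antisymm (hle hij.le) (hle hij.ge)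
    exact (Prod.ext_iff.1 (toLex.injective this)).2
  have : Infinite (Set.range rank) := (Set.infinite_range_of_injective hinj).to_subtype
  let N : ℕ ≃o Set.range rank := Nat.Subtype.orderIsoOfNat (Set.range rank)
  refine ⟨N.toEquiv.trans (Equiv.ofInjective rank hinj).symm, fun m n hmn => hkey (hle ?_)⟩
  have hr : ∀ n, rank ((N.toEquiv.trans (Equiv.ofInjective rank hinj).symm) n) = N n := fun n =>
    Equiv.apply_ofInjective_symm hinj (N n)
  rw [hr, hr]
  exact N.monotone hmn

/-! ### A trapezoid inequality for powers -/

section Trapezoid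

/-- The left side is the integral of the convex function `σ t^(σ-1)` over `[y, x]`, the right side
its trapezoid approximation. The difference has derivative in `x` equal to `σ/2` times the gap
between `y^(σ-1)` and the tangent at `x`. -/
theorem rpow_sub_rpow_le_trapezoid {σ x y : ℝ} (hσ : 2 ≤ σ) (hy : 0 < y) (hxy : y ≤ x) :
    x ^ σ - y ^ σ ≤ σ / 2 * (x ^ (σ - 1) + y ^ (σ - 1)) * (x - y) := by
  let φ : ℝ → ℝ := fun x => σ / 2 * (x ^ (σ - 1) + y ^ (σ - 1)) * (x - y) - x ^ σ
  have hderiv : ∀ t, 0 < t → HasDerivAt φ (σ / 2 * ((σ - 1) * t ^ (σ - 1 - 1)) * (t - y) +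
      σ / 2 * (t ^ (σ - 1) + y ^ (σ - 1)) * 1 - σ * t ^ (σ - 1)) t := fun t ht => by
    have h1 := Real.hasDerivAt_rpow_const (x := t) (p := σ - 1) (.inl ht.ne')
    have h2 := Real.hasDerivAt_rpow_const (x := t) (p := σ) (.inl ht.ne')
    exact (((h1.add_const _).const_mul _).mul ((hasDerivAt_id t).sub_const y)).sub h2
  have hmono : MonotoneOn φ (Set.Ici y) := by
    refine monotoneOn_of_deriv_nonneg (convex_Ici y)
      (fun t ht => (hderiv t (hy.trans_le ht)).continuousAt.continuousWithinAt)
      (fun t ht => (hderiv t ?_).differentiableAt.differentiableWithinAt) fun t ht => ?_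
    · rw [interior_Ici] at ht
      exact hy.trans ht
    · rw [interior_Ici] at ht
      have ht0 : 0 < t := hy.trans ht
      rw [(hderiv t ht0).deriv]
      have := Dirichlet.rpow_add_mul_sub_le_rpow (σ := σ - 1) (by linarith) ht0 hy.le
      nlinarith
  have := hmono Set.self_mem_Ici hxy hxy
  simp only [φ, sub_self, mul_zero, zero_sub] at this
  linarith

theorem rpow_sub_rpow_mul_le_trapezoid {σ x y : ℝ} (hσ : 2 ≤ σ) (hx : 0 < x) (hy : 0 < y) :
    (x ^ σ - y ^ σ) * (x - y) ≤ σ / 2 * (x ^ (σ - 1) + y ^ (σ - 1)) * (x - y) ^ 2 := by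
  rcases le_total y x with h | h
  · nlinarith [mul_le_mul_of_nonneg_right (rpow_sub_rpow_le_trapezoid hσ hy h) (sub_nonneg.2 h)]
  · nlinarith [mul_le_mul_of_nonneg_right (rpow_sub_rpow_le_trapezoid hσ hx h) (sub_nonneg.2 h)]

end Trapezoid

namespace Dirichlet

/-! ### From sum rules to monotonicity of Riesz means -/

section SumRule

variable {ι : Type*} {e : ι → ℝ} {W : ι → ι → ℝ} {D : ℝ}

/-- Two sum rules imply a Yang-type inequality for Riesz means. -/
theorem sum_rpow_mul_le_of_sum_rules (hsymm : ∀ j k, W j k = W k j) (hW : ∀ j k, 0 ≤ W j k)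
    (h1 : ∀ j, HasSum (fun k => (e k - e j) * W k j) D)
    (h2 : ∀ j, HasSum (fun k => (e k - e j) ^ 2 * W k j) (4 * e j))
    {σ z : ℝ} (hσ : 2 ≤ σ) {J : Finset ι} (hJ : ∀ i, i ∈ J ↔ e i < z) :
    D * ∑ j ∈ J, (z - e j) ^ σ ≤ 2 * σ * ∑ j ∈ J, (z - e j) ^ (σ - 1) * e j := by
  -- For `σ/2` and these powers of `z - e j`, the sum of `F` over all `k` and over `j ∈ J` is the
  -- claimed difference. It remains to see that it is nonnegative.
  let F : ι → ι → ℝ := fun k j => σ / 2 * (z - e j) ^ (σ - 1) * ((e k - e j) ^ 2 * W k j) -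
    (z - e j) ^ σ * ((e k - e j) * W k j)
  have hF : HasSum (fun k => ∑ j ∈ J, F k j)
      (∑ j ∈ J, (σ / 2 * (z - e j) ^ (σ - 1) * (4 * e j) - (z - e j) ^ σ * D)) :=
    hasSum_sum fun j _ => ((h2 j).mul_left _).sub ((h1 j).mul_left _)
  have hout : ∀ k ∉ J, 0 ≤ ∑ j ∈ J, F k j := fun k hk => Finset.sum_nonneg fun j hj => by
    have hk' : z ≤ e k := not_lt.1 fun h => hk ((hJ k).2 h)
    have hj' : 0 < z - e j := sub_pos.2 ((hJ j).1 hj)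
    have e1 : (z - e j) ^ σ = (z - e j) ^ (σ - 1) * (z - e j) := by
      rw [← Real.rpow_add_one hj'.ne', sub_add_cancel]
    have e2 : F k j = (z - e j) ^ (σ - 1) * W k j * (e k - e j) *
        (σ / 2 * (e k - e j) - (z - e j)) := by
      simp only [F, e1]; ring
    rw [e2]
    have h3 : 0 ≤ (z - e j) ^ (σ - 1) := Real.rpow_nonneg hj'.le _
    -- Here `e k - e j ≥ z - e j` since `e k ≥ z`, and `σ/2 ≥ 1`.
    have h4 : 0 ≤ σ / 2 * (e k - e j) - (z - e j) := by nlinarith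
    have h5 : 0 ≤ e k - e j := by linarith
    have := hW k j
    positivity
  have hin : 0 ≤ ∑ k ∈ J, ∑ j ∈ J, F k j := by
    -- On `J × J` only the symmetrised summand has a sign: it is the trapezoid gap for `z - e j` and
    -- `z - e k`, whose difference is `e k - e j`.
    have e1 : 2 * ∑ k ∈ J, ∑ j ∈ J, F k j = ∑ k ∈ J, ∑ j ∈ J, (F k j + F j k) := by
      simp_rw [Finset.sum_add_distrib]
      rw [Finset.sum_comm (f := fun k j => F j k)]
      ring
    have e2 : 0 ≤ ∑ k ∈ J, ∑ j ∈ J, (F k j + F j k) :=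
      Finset.sum_nonneg fun k hk => Finset.sum_nonneg fun j hj => by
        have h := rpow_sub_rpow_mul_le_trapezoid hσ (sub_pos.2 ((hJ j).1 hj))
          (sub_pos.2 ((hJ k).1 hk))
        have e3 : F k j + F j k = W k j * (σ / 2 * ((z - e j) ^ (σ - 1) + (z - e k) ^ (σ - 1)) *
            (z - e j - (z - e k)) ^ 2 -
            ((z - e j) ^ σ - (z - e k) ^ σ) * (z - e j - (z - e k))) := by
          simp only [F, hsymm j k]; ring
        rw [e3]
        exact mul_nonneg (hW k j) (sub_nonneg.2 h)
    linarith
  have := hin.trans (sum_le_hasSum J hout hF)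
  rw [Finset.sum_sub_distrib, ← Finset.sum_mul] at this
  have e4 : ∑ j ∈ J, σ / 2 * (z - e j) ^ (σ - 1) * (4 * e j) =
      2 * σ * ∑ j ∈ J, (z - e j) ^ (σ - 1) * e j := by
    rw [Finset.mul_sum]
    exact Finset.sum_congr rfl fun j _ => by ring
  linarith

/-- Writing `e j = z - (z - e j)` turns the Yang-type inequality into one between Riesz means of
orders `σ` and `σ - 1`. The set `J` may be too large, so one `J` serves for all smaller `z` when
differentiating. -/
theorem sum_rieszFun_mul_le (hsymm : ∀ j k, W j k = W k j) (hW : ∀ j k, 0 ≤ W j k)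
    (h1 : ∀ j, HasSum (fun k => (e k - e j) * W k j) D)
    (h2 : ∀ j, HasSum (fun k => (e k - e j) ^ 2 * W k j) (4 * e j))
    {σ z : ℝ} (hσ : 2 ≤ σ) {J : Finset ι} (hJ : ∀ i, e i < z → i ∈ J) :
    (D + 2 * σ) * ∑ j ∈ J, rieszFun σ z (e j) ≤
      2 * σ * z * ∑ j ∈ J, rieszFun (σ - 1) z (e j) := by
  have hrestrict : ∀ τ > 0, ∑ j ∈ J, rieszFun τ z (e j) =
      ∑ j ∈ J with e j < z, (z - e j) ^ τ := fun τ hτ => by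
    rw [Finset.sum_filter]
    refine Finset.sum_congr rfl fun j _ => ?_
    split_ifs with h
    · rw [rieszFun, max_eq_right (sub_pos.2 h).le]
    · exact rieszFun_eq_zero hτ (not_lt.1 h)
  rw [hrestrict σ (by linarith), hrestrict (σ - 1) (by linarith)]
  have h := sum_rpow_mul_le_of_sum_rules hsymm hW h1 h2 (z := z) hσ
    (J := {j ∈ J | e j < z}) (fun i => by simpa using hJ i)
  have hsplit : ∑ j ∈ J with e j < z, (z - e j) ^ (σ - 1) * e j =
      z * ∑ j ∈ J with e j < z, (z - e j) ^ (σ - 1) - ∑ j ∈ J with e j < z, (z - e j) ^ σ := by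
    rw [Finset.mul_sum, ← Finset.sum_sub_distrib]
    refine Finset.sum_congr rfl fun j hj => ?_
    have hj' : 0 < z - e j := sub_pos.2 (Finset.mem_filter.1 hj).2
    have e1 : (z - e j) ^ σ = (z - e j) ^ (σ - 1) * (z - e j) := by
      rw [← Real.rpow_add_one hj'.ne', sub_add_cancel]
    rw [e1]
    ring
  rw [hsplit] at h
  linarith

theorem hasDerivAt_rieszFun {σ : ℝ} (hσ : 2 ≤ σ) (t z : ℝ) :
    HasDerivAt (fun z => rieszFun σ z t) (σ * rieszFun (σ - 1) z t) z := by
  rcases lt_trichotomy z t with h | h | h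
  · rw [rieszFun_eq_zero (by linarith) h.le, mul_zero]
    refine (hasDerivAt_const z (0 : ℝ)).congr_of_eventuallyEq ?_
    filter_upwards [Iio_mem_nhds h] with y hy
    exact rieszFun_eq_zero (by linarith) (le_of_lt hy)
  · subst h
    rw [rieszFun_eq_zero (by linarith) le_rfl, mul_zero, hasDerivAt_iff_tendsto_slope_zero]
    -- At the kink the difference quotient is exactly the Riesz function of order `σ - 1`, which
    -- tends to zero.
    have hc : Continuous fun s => rieszFun (σ - 1) (z + s) z := by
      unfold rieszFun
      exact Continuous.rpow_const (by fun_prop) fun _ => .inr (by linarith)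
    have h0 : rieszFun (σ - 1) (z + 0) z = 0 := rieszFun_eq_zero (by linarith) (by simp)
    have := hc.tendsto 0
    rw [h0] at this
    refine (this.mono_left nhdsWithin_le_nhds).congr' ?_
    filter_upwards [self_mem_nhdsWithin] with s hs
    rw [rieszFun_eq_zero (by linarith) le_rfl (z := z), sub_zero, smul_eq_mul]
    rcases lt_or_gt_of_ne (show s ≠ 0 from hs) with hs | hs
    · rw [rieszFun_eq_zero (by linarith) (by linarith), rieszFun_eq_zero (by linarith)
        (by linarith), mul_zero]
    · rw [rieszFun, rieszFun, max_eq_right (by linarith), add_sub_cancel_left,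
        Real.rpow_sub_one hs.ne']
      field_simp
  · have h1 := ((hasDerivAt_id z).sub_const t).rpow_const (p := σ)
      (.inl (sub_pos.2 h).ne')
    rw [rieszFun, max_eq_right (sub_pos.2 h).le]
    refine (h1.congr_of_eventuallyEq ?_).congr_deriv (by simp)
    filter_upwards [Ioi_mem_nhds h] with y hy
    rw [rieszFun, max_eq_right (sub_nonneg.2 (le_of_lt hy))]
    rfl

/-- Monotonicity of `z ↦ R_σ(z) / z^(σ + D/2)`. -/
theorem sum_rieszFun_mul_rpow_mono (hsymm : ∀ j k, W j k = W k j) (hW : ∀ j k, 0 ≤ W j k)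
    (h1 : ∀ j, HasSum (fun k => (e k - e j) * W k j) D)
    (h2 : ∀ j, HasSum (fun k => (e k - e j) ^ 2 * W k j) (4 * e j))
    {σ y z : ℝ} (hσ : 2 ≤ σ) {J : Finset ι} (hJ : ∀ i, e i < z → i ∈ J) (hy : 0 < y)
    (hyz : y ≤ z) :
    (∑ j ∈ J, rieszFun σ y (e j)) * y ^ (-(σ + D / 2)) ≤
      (∑ j ∈ J, rieszFun σ z (e j)) * z ^ (-(σ + D / 2)) := by
  let R : ℝ → ℝ := fun t => (∑ j ∈ J, rieszFun σ t (e j)) * t ^ (-(σ + D / 2))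
  have hderiv : ∀ t, 0 < t → HasDerivAt R ((∑ j ∈ J, σ * rieszFun (σ - 1) t (e j)) *
      t ^ (-(σ + D / 2)) + (∑ j ∈ J, rieszFun σ t (e j)) *
        (-(σ + D / 2) * t ^ (-(σ + D / 2) - 1))) t := fun t ht =>
    (HasDerivAt.fun_sum fun j _ => hasDerivAt_rieszFun hσ (e j) t).mul
      (Real.hasDerivAt_rpow_const (.inl ht.ne'))
  have hmono : MonotoneOn R (Set.Icc y z) := by
    refine monotoneOn_of_deriv_nonneg (convex_Icc y z)
      (fun t ht => (hderiv t (hy.trans_le ht.1)).continuousAt.continuousWithinAt)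
      (fun t ht => (hderiv t ?_).differentiableAt.differentiableWithinAt) fun t ht => ?_
    · rw [interior_Icc] at ht
      exact hy.trans ht.1
    · rw [interior_Icc] at ht
      have ht0 : 0 < t := hy.trans ht.1
      rw [(hderiv t ht0).deriv, Real.rpow_sub_one ht0.ne', ← Finset.mul_sum]
      have h := sum_rieszFun_mul_le hsymm hW h1 h2 hσ (z := t) (J := J)
        fun i hi => hJ i (hi.trans ht.2)
      set A := ∑ j ∈ J, rieszFun σ t (e j)
      set B := ∑ j ∈ J, rieszFun (σ - 1) t (e j)
      have hp : 0 < t ^ (-(σ + D / 2)) := Real.rpow_pos_of_pos ht0 _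
      -- The derivative is a positive multiple of the difference of the two sides of
      -- `sum_rieszFun_mul_le`.
      have e1 : σ * B * t ^ (-(σ + D / 2)) + A * (-(σ + D / 2) * (t ^ (-(σ + D / 2)) / t)) =
          t ^ (-(σ + D / 2)) / t / 2 * (2 * σ * t * B - (D + 2 * σ) * A) := by
        field_simp
        ring
      rw [e1]
      have := sub_nonneg.2 h
      positivity
  exact hmono ⟨le_rfl, hyz⟩ ⟨hyz, le_rfl⟩ hyz

end SumRule

/-! ### Eigenbasis, dipole sum rules and existence of the spectrum -/

variable {d : ℕ} {Ω : Set (EuclideanSpace ℝ (Fin d))}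

/-- Each fibre of `e` has as many elements as its eigenspace has dimensions, so it can index an
orthonormal basis there. Distinct eigenspaces are orthogonal, and completeness of eigenfunctions
gives density. The index type is arbitrary, so this applies to any given spectrum and also to
construct one. -/
theorem exists_hilbertBasis_eigenspace (hd : 1 ≤ d) (ho : IsOpen Ω) (hb : Bornology.IsBounded Ω)
    {ι : Type*} {e : ι → ℝ}
    (he : ∀ μ, {i | e i = μ}.encard = Cardinal.toENat (Module.rank ℝ (eigenspace Ω μ))) :
    ∃ b : HilbertBasis ι ℝ (L2 Ω), ∀ i, b i ∈ eigenspace Ω (e i) := by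
  have hfd := finiteDimensional_eigenspace hd ho hb
  have hcard : ∀ μ, {i | e i = μ}.encard = Module.finrank ℝ (eigenspace Ω μ) := fun μ => by
    rw [he, ← Module.finrank_eq_rank, Cardinal.toENat_nat]
  have hequiv : ∀ μ, Nonempty (Fin (Module.finrank ℝ (eigenspace Ω μ)) ≃ {i // e i = μ}) := by
    intro μ
    have hfin : {i | e i = μ}.Finite := Set.finite_of_encard_eq_coe (hcard μ)
    have : Finite {i // e i = μ} := hfin.to_subtype
    refine ⟨(Finite.equivFinOfCardEq ?_).symm⟩
    have := hcard μ
    rw [← hfin.cast_ncard_eq] at this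
    exact_mod_cast this
  have hft : ∀ μ, Fintype {i // e i = μ} := fun μ => Fintype.ofEquiv _ (hequiv μ).some
  let B : ∀ μ, OrthonormalBasis {i // e i = μ} ℝ (eigenspace Ω μ) := fun μ =>
    (stdOrthonormalBasis ℝ (eigenspace Ω μ)).reindex (hequiv μ).some
  let v : ι → L2 Ω := fun i => B (e i) ⟨i, rfl⟩
  have hv : ∀ i μ (h : e i = μ), v i = B μ ⟨i, h⟩ := fun i μ h => by subst h; rfl
  have hmem : ∀ i, v i ∈ eigenspace Ω (e i) := fun i =>
    (B (e i) ⟨i, rfl⟩).2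
  have hon : Orthonormal ℝ v := by
    refine ⟨fun i => ?_, fun i j hij => ?_⟩
    · exact (B (e i)).orthonormal.norm_eq_one ⟨i, rfl⟩
    · by_cases h : e i = e j
      · change inner ℝ (v i) (v j) = 0
        rw [hv i _ h, hv j _ rfl, ← Submodule.coe_inner]
        exact (B (e j)).orthonormal.inner_eq_zero fun h' => hij (congrArg Subtype.val h')
      · exact inner_eq_zero_of_mem_eigenspace h (hmem i) (hmem j)
  have hspan : (Submodule.span ℝ (Set.range v))ᗮ = ⊥ := by
    refine (Submodule.eq_bot_iff _).2 fun f hf => ?_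
    refine eq_zero_of_forall_eigenspace ho hb fun μ u hu => ?_
    refine hf u ?_
    have h := (B μ).sum_repr ⟨u, hu⟩
    have h' := congrArg (eigenspace Ω μ).subtype h
    rw [map_sum] at h'
    rw [show u = (eigenspace Ω μ).subtype ⟨u, hu⟩ from rfl, ← h']
    refine Submodule.sum_mem _ fun i _ => ?_
    rw [map_smul]
    refine Submodule.smul_mem _ _ (Submodule.subset_span ⟨i.1, ?_⟩)
    exact hv i.1 μ i.2
  refine ⟨HilbertBasis.mkOfOrthogonalEqBot hon hspan, fun i => ?_⟩
  rw [HilbertBasis.coe_mkOfOrthogonalEqBot]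
  exact hmem i

/-- The commutator identity for `-Δ` and a coordinate. -/
theorem sub_mul_inner_coordMul (ho : IsOpen Ω) (hb : Bornology.IsBounded Ω) (a : Fin d)
    {μ ν : ℝ} {u v : L2 Ω} {g k : L2Vec Ω} (hu : (u, g) ∈ sobolevH10 Ω)
    (hug : ∀ q ∈ sobolevH10 Ω, inner ℝ g q.2 = μ * inner ℝ u q.1) (hv : (v, k) ∈ sobolevH10 Ω)
    (hvk : ∀ q ∈ sobolevH10 Ω, inner ℝ k q.2 = ν * inner ℝ v q.1) :
    (μ - ν) * inner ℝ u (coordMul ho hb a ℝ v) = -2 * inner ℝ (component Ω a k) u := by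
  -- Each weak equation is tested with `x_a` times the other eigenfunction; the terms `x_a ∇u · ∇v`
  -- cancel in the difference.
  have h1 := hug _ (coordMul_mem ho hb a hv)
  have h2 := hvk _ (coordMul_mem ho hb a hu)
  have h3 := inner_component_eq_neg a hu hv
  dsimp only at h1 h2 h3
  rw [inner_add_right, inner_axisField] at h1 h2
  rw [← inner_coordMul_left, real_inner_comm g, ← inner_coordMul_left ho hb a v u,
    real_inner_comm u] at h2
  rw [real_inner_comm _ u] at h3
  have h4 : inner ℝ u (component Ω a k) = inner ℝ (component Ω a k) u := real_inner_comm _ _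
  have h5 : inner ℝ (coordMul ho hb a ℝ v) u = inner ℝ u (coordMul ho hb a ℝ v) :=
    real_inner_comm _ _
  rw [h4, h5] at h2
  linarith

section Basis

variable {ι : Type*} {e : ι → ℝ} (ho : IsOpen Ω) (hb : Bornology.IsBounded Ω)
  (b : HilbertBasis ι ℝ (L2 Ω))

/-- The total squared matrix element `∑_a ⟨u_j, x_a u_k⟩²` of the position operator. -/
def dipole (j k : ι) : ℝ := ∑ a, inner ℝ (b j) (coordMul ho hb a ℝ (b k)) ^ 2

theorem dipole_comm (j k : ι) : dipole ho hb b j k = dipole ho hb b k j := by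
  unfold dipole
  refine Finset.sum_congr rfl fun a _ => ?_
  rw [← inner_coordMul_left, real_inner_comm]

theorem dipole_nonneg (j k : ι) : 0 ≤ dipole ho hb b j k :=
  Finset.sum_nonneg fun _ _ => sq_nonneg _

variable {b}

/-- The commutator identity removes one factor, leaving `-2 ⟨∂_a u_j, u_k⟩ ⟨u_k, x_a u_j⟩`. Parseval
sums this to `-2 ⟨∂_a u_j, x_a u_j⟩ = 1` for each of the `d` directions. -/
theorem hasSum_sub_mul_dipole (he : ∀ i, b i ∈ eigenspace Ω (e i)) (j : ι) :
    HasSum (fun k => (e k - e j) * dipole ho hb b k j) (d : ℝ) := by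
  choose g hg hge using fun i => mem_eigenspace_iff.1 (he i)
  have h : ∀ a : Fin d, HasSum
      (fun k => (e k - e j) * inner ℝ (b k) (coordMul ho hb a ℝ (b j)) ^ 2) (1 : ℝ) := by
    intro a
    have h1 := norm_sq_eq_neg_two_mul_inner ho hb a (hg j)
    rw [b.orthonormal.norm_eq_one, one_pow] at h1
    rw [h1]
    have hs := (b.hasSum_inner_mul_inner (component Ω a (g j)) (coordMul ho hb a ℝ (b j))).mul_left
      (-2)
    refine (congrArg (HasSum · _) (funext fun k => ?_)).mpr hs
    rw [sq, ← mul_assoc, sub_mul_inner_coordMul ho hb a (hg k) (hge k) (hg j) (hge j), mul_assoc]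
  simp_rw [dipole, Finset.mul_sum]
  simpa using hasSum_sum fun (a : Fin d) (_ : a ∈ Finset.univ) => h a

/-- The commutator identity, squared, turns the sum over `k` into `4‖∂_a u_j‖²` by Parseval; summing
over `a` gives `4‖∇u_j‖² = 4 e j`. -/
theorem hasSum_sub_sq_mul_dipole (he : ∀ i, b i ∈ eigenspace Ω (e i)) (j : ι) :
    HasSum (fun k => (e k - e j) ^ 2 * dipole ho hb b k j) (4 * e j) := by
  choose g hg hge using fun i => mem_eigenspace_iff.1 (he i)
  have h : ∀ a : Fin d, HasSum
      (fun k => (e k - e j) ^ 2 * inner ℝ (b k) (coordMul ho hb a ℝ (b j)) ^ 2)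
      (4 * ‖component Ω a (g j)‖ ^ 2) := by
    intro a
    rw [← real_inner_self_eq_norm_sq]
    have hs := (b.hasSum_inner_mul_inner (component Ω a (g j)) (component Ω a (g j))).mul_left 4
    refine (congrArg (HasSum · _) (funext fun k => ?_)).mpr hs
    rw [← mul_pow, sub_mul_inner_coordMul ho hb a (hg k) (hge k) (hg j) (hge j),
      real_inner_comm (b k)]
    ring
  have hn : ‖g j‖ ^ 2 = e j := by
    have := hge j _ (hg j)
    rwa [real_inner_self_eq_norm_sq, real_inner_self_eq_norm_sq, b.orthonormal.norm_eq_one,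
      one_pow, mul_one] at this
  have hs := hasSum_sum fun (a : Fin d) (_ : a ∈ Finset.univ) => h a
  simp_rw [dipole, Finset.mul_sum]
  rwa [← Finset.mul_sum, ← norm_sq_eq_sum_component, hn] at hs

end Basis

/-- For a finite basis, summing the first sum rule over `j` gives `d` times its size, while
antisymmetry in `(j, k)` makes the same double sum zero. The basis would be empty, yet `L²(Ω)` is
nonzero. -/
theorem infinite_of_hilbertBasis (ho : IsOpen Ω) (hb : Bornology.IsBounded Ω) (hd : 1 ≤ d)
    (hne : Ω.Nonempty) {ι : Type*} {e : ι → ℝ} {b : HilbertBasis ι ℝ (L2 Ω)}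
    (he : ∀ i, b i ∈ eigenspace Ω (e i)) : Infinite ι := by
  refine not_finite_iff_infinite.1 fun hfin => ?_
  have := Fintype.ofFinite ι
  have h1 : ∑ j, ∑ k, (e k - e j) * dipole ho hb b k j = Fintype.card ι * d := by
    simp_rw [fun j => (hasSum_fintype _).unique (hasSum_sub_mul_dipole ho hb he j)]
    simp
  have h2 : ∑ j, ∑ k, (e k - e j) * dipole ho hb b k j =
      -∑ j, ∑ k, (e k - e j) * dipole ho hb b k j := by
    conv_lhs => rw [Finset.sum_comm]
    rw [← Finset.sum_neg_distrib]
    refine Finset.sum_congr rfl fun j _ => ?_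
    rw [← Finset.sum_neg_distrib]
    refine Finset.sum_congr rfl fun k _ => ?_
    rw [dipole_comm]
    ring
  have h3 : (Fintype.card ι : ℝ) * d = 0 := by linarith
  have hd0 : (d : ℝ) ≠ 0 := by exact_mod_cast (Nat.one_le_iff_ne_zero.1 hd)
  have h4 : Fintype.card ι = 0 := by
    exact_mod_cast (mul_eq_zero.1 h3).resolve_right hd0
  have hempty := Fintype.card_eq_zero_iff.1 h4
  have h5 : ∀ f : L2 Ω, f = 0 := fun f =>
    (b.hasSum_repr f).unique (by simp)
  have h6 := norm_sq_wave_add hb 0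
  rw [h5 (wave hb 0 0), h5 (wave hb (Real.pi / 2) 0)] at h6
  have h7 : 0 < volume.real Ω :=
    ENNReal.toReal_pos (ho.measure_pos volume hne).ne' hb.measure_lt_top.ne
  simp at h6
  linarith

theorem exists_isSpectrum (hd : 1 ≤ d) (ho : IsOpen Ω) (hne : Ω.Nonempty)
    (hb : Bornology.IsBounded Ω) : ∃ lam : ℕ → ℝ, IsSpectrum Ω lam := by
  have hfd := finiteDimensional_eigenspace hd ho hb
  -- The tautological index: each real `μ` repeated as often as its multiplicity.
  let ι := Σ μ : ℝ, Fin (Module.finrank ℝ (eigenspace Ω μ))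
  have hι : ∀ μ, {i : ι | i.1 = μ}.encard = Cardinal.toENat (Module.rank ℝ (eigenspace Ω μ)) := by
    intro μ
    rw [← Module.finrank_eq_rank, Cardinal.toENat_nat]
    have : {i : ι | i.1 = μ} = Set.range (Sigma.mk μ) := by
      ext ⟨ν, i⟩
      simp [eq_comm]
    rw [this, ← Set.image_univ, sigma_mk_injective.encard_image, Set.encard_univ]
    simp
  obtain ⟨b, hbe⟩ := exists_hilbertBasis_eigenspace hd ho hb hι
  have := infinite_of_hilbertBasis ho hb hd hne hbe
  obtain ⟨f, hf⟩ := exists_monotone_enumeration (fun i : ι => i.1)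
    (finite_setOf_le hd ho hb b.orthonormal hbe)
  refine ⟨_, hf, fun μ => ?_⟩
  rw [← hι μ, ← f.injective.encard_image]
  exact congrArg Set.encard (f.image_preimage {i : ι | i.1 = μ})

end Dirichlet

end

/-! ### Assembly of the two bounds -/

theorem mainTheorem2 (d : ℕ) (hd : 1 ≤ d) (Ω : Set (EuclideanSpace ℝ (Fin d)))
    (hopen : IsOpen Ω) (hne : Ω.Nonempty) (hbdd : Bornology.IsBounded Ω) :
    (∃ lam : ℕ → ℝ, Dirichlet.IsSpectrum Ω lam) ∧
    ∀ lam : ℕ → ℝ, Dirichlet.IsSpectrum Ω lam → 0 < lam 0 ∧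
      ∀ σ z : ℝ, 2 ≤ σ → (1 + 2 * σ / (d : ℝ)) * lam 0 ≤ z →
        Summable (Dirichlet.rieszTerm lam σ z) ∧
        (2 * σ / (d : ℝ)) ^ σ * lam 0 ^ (-((d : ℝ) / 2)) *
            (z / (1 + 2 * σ / (d : ℝ))) ^ (σ + (d : ℝ) / 2)
          ≤ Dirichlet.rieszMean lam σ z ∧
        Dirichlet.rieszMean lam σ z
          ≤ Dirichlet.classicalConst σ d * volume.real Ω * z ^ (σ + (d : ℝ) / 2) := by
  refine ⟨Dirichlet.exists_isSpectrum hd hopen hne hbdd, fun lam hlam => ?_⟩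
  obtain ⟨b, hb⟩ :=
    Dirichlet.exists_hilbertBasis_eigenspace hd hopen hbdd hlam.multiplicity
  have hpos : 0 < lam 0 := by
    by_contra h
    have h0 := hb 0
    rw [Dirichlet.eigenspace_eq_bot hd hopen hbdd (not_lt.1 h), Submodule.mem_bot] at h0
    exact b.orthonormal.ne_zero 0 h0
  refine ⟨hpos, fun σ z hσ hz => ?_⟩
  have hd0 : (0 : ℝ) < d := by exact_mod_cast hd
  set c : ℝ := 2 * σ / d with hc
  have hc0 : 0 < c := by positivity
  -- This `y` maximises `(y - λ_1)^σ / y^(σ+d/2)`, the one-eigenvalue lower bound for the monotone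
  -- quotient.
  set y : ℝ := (1 + c) * lam 0 with hy
  have hy0 : 0 < y := by positivity
  have hz0 : 0 < z := hy0.trans_le hz
  have hbound : ∀ s : Finset ℕ, ∑ k ∈ s, Dirichlet.rieszTerm lam σ z k ≤
      Dirichlet.classicalConst σ d * volume.real Ω * z ^ (σ + (d : ℝ) / 2) := fun s =>
    Dirichlet.sum_rieszFun_le hd hopen hbdd (by linarith) hz0 b.orthonormal hb s
  have hnonneg : ∀ k, 0 ≤ Dirichlet.rieszTerm lam σ z k := fun k => Dirichlet.rieszFun_nonneg _
  have hsum : Summable (Dirichlet.rieszTerm lam σ z) := summable_of_sum_le hnonneg hbound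
  refine ⟨hsum, ?_, hsum.tsum_le_of_sum_le hbound⟩
  have hfin := Dirichlet.finite_setOf_le hd hopen hbdd b.orthonormal hb z
  let J : Finset ℕ := hfin.toFinset
  have hJ : ∀ i, lam i < z → i ∈ J := fun i hi => hfin.mem_toFinset.2 hi.le
  have hmono := Dirichlet.sum_rieszFun_mul_rpow_mono
    (Dirichlet.dipole_comm hopen hbdd b) (Dirichlet.dipole_nonneg hopen hbdd b)
    (Dirichlet.hasSum_sub_mul_dipole hopen hbdd hb)
    (Dirichlet.hasSum_sub_sq_mul_dipole hopen hbdd hb) hσ hJ hy0 hz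
  -- Only the first eigenvalue is kept, with `y - λ_1 = c λ_1`.
  have hfirst : (c * lam 0) ^ σ ≤ ∑ j ∈ J, Dirichlet.rieszFun σ y (lam j) := by
    have h0 : (0 : ℕ) ∈ J := hJ 0 (by nlinarith)
    refine le_trans (le_of_eq ?_)
      (Finset.single_le_sum (fun j _ => Dirichlet.rieszFun_nonneg (lam j)) h0)
    have : y - lam 0 = c * lam 0 := by rw [hy]; ring
    rw [Dirichlet.rieszFun, this, max_eq_right (by positivity)]
  refine le_trans ?_ (hsum.sum_le_tsum J fun k _ => hnonneg k)
  change _ ≤ ∑ j ∈ J, Dirichlet.rieszFun σ z (lam j)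
  have hyp : 0 < y ^ (-(σ + (d : ℝ) / 2)) := Real.rpow_pos_of_pos hy0 _
  have hzp : 0 < z ^ (σ + (d : ℝ) / 2) := Real.rpow_pos_of_pos hz0 _
  have hlow := mul_le_mul_of_nonneg_right
    ((mul_le_mul_of_nonneg_right hfirst hyp.le).trans hmono) hzp.le
  rw [mul_assoc _ (z ^ _) (z ^ _), ← Real.rpow_add hz0, neg_add_cancel, Real.rpow_zero,
    mul_one] at hlow
  refine le_trans (le_of_eq ?_) hlow
  rw [hy, Real.mul_rpow hc0.le hpos.le, Real.mul_rpow (by positivity) hpos.le,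
    Real.div_rpow hz0.le (by positivity), Real.rpow_neg (by positivity : (0 : ℝ) ≤ 1 + c)]
  have e : lam 0 ^ (-((d : ℝ) / 2)) = lam 0 ^ σ * lam 0 ^ (-(σ + (d : ℝ) / 2)) := by
    rw [← Real.rpow_add hpos]
    congr 1
    ring
  rw [e]
  ring
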